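/- Let $E_8$ be the $E_8$ root lattice, i.e. $\mathbb{Z}^8$ with the inner product $(\cdot,\cdot)$ whose Gram matrix is the Cartan matrix of type $E_8$, and let $\mathrm{Aut}(E_8)$ be the group of additive automorphisms of $E_8$ preserving the inner product. Equip the $\mathbb{F}_2$-space $E_8/2E_8$ with the quadratic form $Q(x+2E_8)=\tfrac12(x,x) \bmod 2$. Let $O(Q)$ be the group of all linear isometries of $Q$, and let $O_8^+(2)$ be its commutator subgroup. An isotropic point is a nonzero vector $v$ with $Q(v)=0$; an isotropic 4-space is a 4-dimensional subspace on which $Q$ vanishes identically. (1) $(E_8/2E_8,Q)$ is 8-dimensional of plus type, i.e. isometric to $(\mathbb{F}_2^4)^*\oplus\mathbb{F}_2^4$ with the form $(f,x)\mapsto f(x)$, and it has exactly 135 isotropic points. (2) There exist nine isotropic 4-spaces $V_0,\dots,V_8$ that intersect pairwise in $0$ and together contain all 135 isotropic points; each of them contains 15 isotropic points. Any two isotropic 4-spaces that intersect in $0$ can be taken as $V_0$ and $V_1$ in such a partition. (3) Let $V_0,\dots,V_8$ be any such partition. There are subgroups $H_{01},H_{02},H_{12}\le O_8^+(2)$, with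 a common subgroup $K$, such that: for each pair $\{i,j\}\subset\{0,1,2\}$ the group $H_{ij}\cong A_7$ fixes $V_i$ and $V_j$ and acts faithfully as the alternating group on the other seven of the nine spaces; $K\cong A_6$ fixes $V_0,V_1,V_2$ and acts faithfully as the alternating group on $V_3,\dots,V_8$; and the subgroup $G\le O_8^+(2)$ generated by $H_{01},H_{02},H_{12}$ acts faithfully on $\{V_0,\dots,V_8\}$ as the alternating group $A_9$. Moreover $G$ is the full stabilizer of the partition $\{V_0,\dots,V_8\}$ in $O(Q)$. (4) For any such partition, let $S\le\mathrm{Aut}(E_8)$ be the group of all automorphisms of $E_8$ whose reduction modulo 2 permutes the nine spaces $V_0,\dots,V_8$. Then $S$ is the double cover $2A_9$: the action of $S$ on $\{V_0,\dots,V_8\}$ has image exactly the alternating group $A_9$ and kernel $\{\pm1\}$, and the extension $1\to\{\pm1\}\to S\to A_9\to1$ does not split. -/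

import Mathlib

namespace E8Spread

/-- The underlying group of the `E₈` lattice, written in coordinates with respect to a base of
simple roots. -/
abbrev Lattice : Type := Fin 8 → ℤ

/-- The inner product of the `E₈` lattice: the simple roots have the Cartan matrix `E₈` as
their Gram matrix. -/
def inner : LinearMap.BilinForm ℤ Lattice := Matrix.toBilin' CartanMatrix.E₈

/-- The half norm `(x, x) / 2` in coordinates. -/
def halfNorm (x : Lattice) : ℤ :=
  x 0 ^ 2 + x 1 ^ 2 + x 2 ^ 2 + x 3 ^ 2 + x 4 ^ 2 + x 5 ^ 2 + x 6 ^ 2 + x 7 ^ 2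
    - x 0 * x 2 - x 1 * x 3 - x 2 * x 3 - x 3 * x 4 - x 4 * x 5 - x 5 * x 6 - x 6 * x 7

theorem inner_eq (x y : Lattice) : inner x y =
    2 * (x 0 * y 0 + x 1 * y 1 + x 2 * y 2 + x 3 * y 3 + x 4 * y 4 + x 5 * y 5 + x 6 * y 6
      + x 7 * y 7)
    - (x 0 * y 2 + x 2 * y 0) - (x 1 * y 3 + x 3 * y 1) - (x 2 * y 3 + x 3 * y 2)
    - (x 3 * y 4 + x 4 * y 3) - (x 4 * y 5 + x 5 * y 4) - (x 5 * y 6 + x 6 * y 5)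
    - (x 6 * y 7 + x 7 * y 6) := by
  simp [inner, Matrix.toBilin'_apply, Fin.sum_univ_eight, CartanMatrix.E₈]
  ring

theorem inner_self (x : Lattice) : inner x x = 2 * halfNorm x := by
  rw [inner_eq, halfNorm]; ring

theorem halfNorm_add (x y : Lattice) :
    halfNorm (x + y) = halfNorm x + halfNorm y + inner x y := by
  rw [inner_eq]; simp only [halfNorm, Pi.add_apply]; ring

theorem halfNorm_eq (x : Lattice) : halfNorm x = inner x x / 2 := by
  rw [inner_self]; simp

/-- `Aut(E₈)`: the additive automorphisms of the lattice that preserve the inner product. -/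
def Aut : Subgroup (Lattice ≃ₗ[ℤ] Lattice) where
  carrier := {g | ∀ x y, inner (g x) (g y) = inner x y}
  mul_mem' {g h} hg hh x y := by
    rw [LinearEquiv.mul_apply, LinearEquiv.mul_apply, hg, hh]
  one_mem' _ _ := rfl
  inv_mem' {g} hg x y := by
    have h := hg (g⁻¹ x) (g⁻¹ y)
    have e : ∀ z, g (g⁻¹ z) = z := fun z => g.apply_symm_apply z
    rw [e, e] at h
    exact h.symm

/-- The sublattice `2 E₈`. -/
def two : Submodule ℤ Lattice := LinearMap.range ((2 : ℤ) • (LinearMap.id : Lattice →ₗ[ℤ] Lattice))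

theorem mem_two {x : Lattice} : x ∈ two ↔ ∃ y : Lattice, (2 : ℤ) • y = x := Iff.rfl

/-- The space `E₈ / 2 E₈`. -/
abbrev Mod2 : Type := Lattice ⧸ two

instance : Module (ZMod 2) Mod2 :=
  AddCommGroup.zmodModule (n := 2) (by
    intro x
    obtain ⟨x, rfl⟩ := Submodule.Quotient.mk_surjective two x
    rw [← Submodule.Quotient.mk_smul, Submodule.Quotient.mk_eq_zero, mem_two]
    exact ⟨x, by simp [two_smul]⟩)

/-- The quadratic form `x ↦ (x, x) / 2 mod 2` on `E₈ / 2 E₈`, as a function. -/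
def qFun : Mod2 → ZMod 2 :=
  Quotient.lift (fun x : Lattice => ((inner x x / 2 : ℤ) : ZMod 2)) (by
    intro a b hab
    have h : a - b ∈ two := (Submodule.quotientRel_def two).1 hab
    obtain ⟨c, hc⟩ := mem_two.1 h
    have e : a = b + (2 : ℤ) • c := by rw [hc]; abel
    have h2 : halfNorm ((2 : ℤ) • c) = 4 * halfNorm c := by
      simp only [halfNorm, Pi.smul_apply, smul_eq_mul]; ring
    have h4 : (4 : ZMod 2) = 0 := by decide
    have h3 : (2 : ZMod 2) = 0 := by decide
    simp only [← halfNorm_eq]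
    rw [e, halfNorm_add, h2, map_smul, smul_eq_mul]
    push_cast
    rw [h4, h3]
    ring)

theorem qFun_mk (x : Lattice) : qFun (Submodule.Quotient.mk x) = ((inner x x / 2 : ℤ) : ZMod 2) :=
  rfl

theorem polar_qFun_mk (x y : Lattice) :
    QuadraticMap.polar qFun (Submodule.Quotient.mk x) (Submodule.Quotient.mk y) =
      ((inner x y : ℤ) : ZMod 2) := by
  rw [QuadraticMap.polar, ← Submodule.Quotient.mk_add, qFun_mk, qFun_mk, qFun_mk, ← halfNorm_eq,
    ← halfNorm_eq, ← halfNorm_eq, halfNorm_add]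
  push_cast
  ring

theorem qFun_zero : qFun 0 = 0 := by
  have h := qFun_mk 0
  simpa using h

/-- The quadratic form `x ↦ (x, x) / 2 mod 2` on the `𝔽₂`-space `E₈ / 2 E₈`. -/
def Q : QuadraticForm (ZMod 2) Mod2 :=
  QuadraticMap.ofPolar qFun
    (fun a x => by
      fin_cases a
      · change qFun ((0 : ZMod 2) • x) = (0 * 0 : ZMod 2) • qFun x
        rw [zero_smul, qFun_zero]; simp
      · change qFun ((1 : ZMod 2) • x) = (1 * 1 : ZMod 2) • qFun x
        rw [one_smul]; simp)
    (fun x x' y => by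
      obtain ⟨x, rfl⟩ := Submodule.Quotient.mk_surjective two x
      obtain ⟨x', rfl⟩ := Submodule.Quotient.mk_surjective two x'
      obtain ⟨y, rfl⟩ := Submodule.Quotient.mk_surjective two y
      rw [← Submodule.Quotient.mk_add, polar_qFun_mk, polar_qFun_mk, polar_qFun_mk, map_add,
        LinearMap.add_apply]
      push_cast
      rfl)
    (fun a x y => by
      fin_cases a
      · change QuadraticMap.polar qFun ((0 : ZMod 2) • x) y =
          (0 : ZMod 2) • QuadraticMap.polar qFun x y
        rw [zero_smul, zero_smul, QuadraticMap.polar, zero_add, qFun_zero]; simp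
      · change QuadraticMap.polar qFun ((1 : ZMod 2) • x) y =
          (1 : ZMod 2) • QuadraticMap.polar qFun x y
        rw [one_smul, one_smul])

theorem Q_mk (x : Lattice) : Q (Submodule.Quotient.mk x) = ((inner x x / 2 : ℤ) : ZMod 2) :=
  rfl

/-- The isotropic points of `E₈ / 2 E₈`; a one-dimensional subspace over `𝔽₂` is the same as a
nonzero vector. -/
def isotropicPoints : Set Mod2 := {v | v ≠ 0 ∧ Q v = 0}

/-- Totally isotropic (that is, totally singular) 4-spaces. -/
def IsIsotropic4Space (W : Submodule (ZMod 2) Mod2) : Prop :=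
  Module.finrank (ZMod 2) W = 4 ∧ ∀ v ∈ W, Q v = 0

/-- Nine pairwise disjoint totally isotropic 4-spaces (labelled by `0, …, 8`) that partition the
isotropic points. -/
structure IsPartition (V : Fin 9 → Submodule (ZMod 2) Mod2) : Prop where
  isotropic : ∀ i, IsIsotropic4Space (V i)
  disjoint : ∀ i j, i ≠ j → Disjoint (V i) (V j)
  cover : ∀ v ∈ isotropicPoints, ∃ i, v ∈ V i

/-- The full orthogonal group of the quadratic space `E₈ / 2 E₈`. -/
def orthogonalGroup : Subgroup (Mod2 ≃ₗ[ZMod 2] Mod2) where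
  carrier := {g | ∀ x, Q (g x) = Q x}
  mul_mem' {g h} hg hh x := by rw [LinearEquiv.mul_apply, hg, hh]
  one_mem' _ := rfl
  inv_mem' {g} hg x := by
    have h := hg (g⁻¹ x)
    have e : g (g⁻¹ x) = x := g.apply_symm_apply x
    rw [e] at h
    exact h.symm

/-- The group `O₈⁺(2)` (a simple group of index 2 in the full orthogonal group): the commutator
subgroup of the full orthogonal group. -/
def O8plus : Subgroup (Mod2 ≃ₗ[ZMod 2] Mod2) := ⁅orthogonalGroup, orthogonalGroup⁆

/-- The linear automorphisms of `E₈ / 2 E₈` that permute the members of a family of nine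
subspaces. -/
def permuters (V : Fin 9 → Submodule (ZMod 2) Mod2) : Subgroup (Mod2 ≃ₗ[ZMod 2] Mod2) where
  carrier := {g | ∃ σ : Equiv.Perm (Fin 9), ∀ i, (V i).map (g : Mod2 →ₗ[ZMod 2] Mod2) = V (σ i)}
  mul_mem' {g h} hg hh := by
    obtain ⟨σ, hσ⟩ := hg
    obtain ⟨τ, hτ⟩ := hh
    refine ⟨σ * τ, fun i => ?_⟩
    have h1 : V ((σ * τ) i) = ((V i).map (h : Mod2 →ₗ[ZMod 2] Mod2)).map
        (g : Mod2 →ₗ[ZMod 2] Mod2) := by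
      rw [Equiv.Perm.mul_apply, hτ, hσ]
    rw [h1]
    exact Submodule.map_comp (h : Mod2 →ₗ[ZMod 2] Mod2) (g : Mod2 →ₗ[ZMod 2] Mod2) (V i)
  one_mem' := ⟨1, fun i => Submodule.map_id _⟩
  inv_mem' {g} hg := by
    obtain ⟨σ, hσ⟩ := hg
    refine ⟨σ⁻¹, fun i => ?_⟩
    have h := hσ (σ⁻¹ i)
    rw [show σ (σ⁻¹ i) = i from σ.apply_symm_apply i] at h
    ext x
    constructor
    · rintro ⟨y, hy, rfl⟩
      rw [SetLike.mem_coe, ← h] at hy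
      obtain ⟨z, hz, rfl⟩ := hy
      have e : g⁻¹ (g z) = z := g.symm_apply_apply z
      change g⁻¹ (g z) ∈ _
      rw [e]
      exact hz
    · intro hx
      have e : g⁻¹ (g x) = x := g.symm_apply_apply x
      refine ⟨g x, ?_, e⟩
      rw [SetLike.mem_coe, ← h]
      exact Submodule.mem_map_of_mem hx

/-- The group `G` fixes each `V i` with `i ∉ s`, and acts on the `V i` with `i ∈ s` faithfully and
as the full alternating group of `s`. In particular `G` is isomorphic to that group. -/
def ActsAsAlternating (G : Subgroup (Mod2 ≃ₗ[ZMod 2] Mod2))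
    (V : Fin 9 → Submodule (ZMod 2) Mod2) (s : Finset (Fin 9)) : Prop :=
  (∀ g ∈ G, ∀ i ∉ s, (V i).map (g : Mod2 →ₗ[ZMod 2] Mod2) = V i) ∧
  ∃ φ : G ≃* alternatingGroup s, ∀ (g : G) (i : s),
    (V i).map ((g : Mod2 ≃ₗ[ZMod 2] Mod2) : Mod2 →ₗ[ZMod 2] Mod2) =
      V ((φ g : Equiv.Perm s) i)

theorem map_two (g : Lattice ≃ₗ[ℤ] Lattice) : two.map (g : Lattice →ₗ[ℤ] Lattice) = two := by
  ext x
  simp only [Submodule.mem_map, mem_two]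
  constructor
  · rintro ⟨_, ⟨z, rfl⟩, rfl⟩
    exact ⟨g z, (map_smul g (2 : ℤ) z).symm⟩
  · rintro ⟨z, rfl⟩
    refine ⟨(2 : ℤ) • g.symm z, ⟨_, rfl⟩, ?_⟩
    change g ((2 : ℤ) • g.symm z) = _
    rw [map_smul, g.apply_symm_apply]

/-- The automorphism of `E₈ / 2 E₈` induced by an additive automorphism of the lattice. -/
def reduction : (Lattice ≃ₗ[ℤ] Lattice) →* (Mod2 ≃ₗ[ZMod 2] Mod2) where
  toFun g :=
    { (Submodule.Quotient.equiv two two g (map_two g)).toAddEquiv with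
      map_smul' := fun c x =>
        ZMod.map_smul (n := 2) (Submodule.Quotient.equiv two two g (map_two g)) c x }
  map_one' := by
    ext x
    obtain ⟨x, rfl⟩ := Submodule.Quotient.mk_surjective two x
    rfl
  map_mul' g h := by
    ext x
    obtain ⟨x, rfl⟩ := Submodule.Quotient.mk_surjective two x
    rfl

theorem reduction_mk (g : Lattice ≃ₗ[ℤ] Lattice) (x : Lattice) :
    reduction g (Submodule.Quotient.mk x) = Submodule.Quotient.mk (g x) := rfl

/-- The stabilizer in `Aut(E₈)` of a family of nine subspaces of `E₈ / 2 E₈`: the automorphisms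
of the lattice whose reduction modulo 2 permutes the nine subspaces. -/
def latticeStabilizer (V : Fin 9 → Submodule (ZMod 2) Mod2) : Subgroup (Lattice ≃ₗ[ℤ] Lattice) :=
  Aut ⊓ (permuters V).comap reduction

end E8Spread

/-!
The quadratic space `E₈ / 2 E₈` is identified with the hyperbolic model `𝔽₂⁴ ⊕ 𝔽₂⁴`, with the form
`(y, x) ↦ y · x`. Two disjoint isotropic 4-spaces are dual to each other under the polar form, so an
isometry with the model moves them to the two summands (`exists_isometry_of_disjoint`). An isotropic
4-space disjoint from the first summand is then the graph `{(A x, x)}` of an alternating `4 × 4`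
matrix `A`, and two such graphs are disjoint exactly if the difference of the matrices is
nonsingular. Hence a partition of the isotropic points amounts to eight
alternating matrices with nonsingular pairwise differences.

Such a set of matrices is unique up to a translation by an alternating matrix
(`exists_translate`). Under the Klein correspondence the 28 nonsingular alternating matrices are the
edges of the complete graph on eight points, and the Pfaffian of `a + b` is `1` exactly if the edges
`a` and `b` meet in one point; seven edges that meet pairwise form a star, and the eight stars are
translates of each other. Since the shear `(y, x) ↦ (y + T x, x)` by an alternating matrix `T` is an
isometry, every partition is the image of one standard spread (`IsPartition.exists_isometry`).

The stabilizer of the standard spread is determined as follows. An explicit 9-cycle and an explicit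
3-cycle are induced by isometries, and they generate the alternating group
(`alternatingGroup_le_spreadPerms`). Conversely, an isometry that fixes all members but possibly two
is the identity: the quotients of five of the matrices generate the full matrix algebra, so that
only scalars intertwine the five (`eq_smul_one_of_intertwines`, `eq_id_of_preserves`). Therefore the
action is faithful, and no transposition is induced (`spreadPerms_le_alternatingGroup`). The
subgroups of type `A₆` and `A₇` are the stabilizers of labels in this `A₉`; they lie in `O₈⁺(2)`
because the alternating groups of degree at least five are perfect.

For the lattice, every nonsingular vector of `E₈ / 2 E₈` is the class of a root, unique up to sign.
The images of the simple roots under an isometry can therefore be lifted to roots, and since the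
Dynkin diagram is a tree the signs can be chosen so that the Gram matrix is the Cartan matrix. So
reduction modulo 2 maps `Aut(E₈)` onto the orthogonal group (`exists_reduction_eq`), with kernel
`±1` (`eq_one_or_neg_of_reduction_eq_one`). The extension does not split, because some lattice
automorphism of square `-1` acts on the spread as an involution (`IsPartition.exists_sq_eq_neg`).
-/

namespace E8Spread

open Matrix

/-! ### Roots of the lattice -/

/-- Completing squares along the Dynkin diagram. -/
theorem halfNorm_sum_sq (x : Lattice) : 120 * halfNorm x =
    30 * (2 * x 0 - x 2) ^ 2 + 30 * (2 * x 1 - x 3) ^ 2 + 10 * (3 * x 2 - 2 * x 3) ^ 2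
      + 30 * (2 * x 7 - x 6) ^ 2 + 10 * (3 * x 6 - 2 * x 5) ^ 2 + 5 * (4 * x 5 - 3 * x 4) ^ 2
      + 3 * (5 * x 4 - 4 * x 3) ^ 2 + 2 * x 3 ^ 2 := by
  rw [halfNorm]; ring

theorem halfNorm_nonneg (x : Lattice) : 0 ≤ halfNorm x := by
  have h := halfNorm_sum_sq x
  have : 0 ≤ 120 * halfNorm x := by rw [h]; positivity
  omega

theorem eq_zero_of_halfNorm_nonpos {x : Lattice} (hx : halfNorm x ≤ 0) : x = 0 := by
  have h := halfNorm_sum_sq x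
  have e1 := sq_nonneg (2 * x 0 - x 2)
  have e2 := sq_nonneg (2 * x 1 - x 3)
  have e3 := sq_nonneg (3 * x 2 - 2 * x 3)
  have e4 := sq_nonneg (2 * x 7 - x 6)
  have e5 := sq_nonneg (3 * x 6 - 2 * x 5)
  have e6 := sq_nonneg (4 * x 5 - 3 * x 4)
  have e7 := sq_nonneg (5 * x 4 - 4 * x 3)
  have e8 := sq_nonneg (x 3)
  have f1 : 2 * x 0 - x 2 = 0 := pow_eq_zero_iff two_ne_zero |>.1 (by linarith)
  have f2 : 2 * x 1 - x 3 = 0 := pow_eq_zero_iff two_ne_zero |>.1 (by linarith)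
  have f3 : 3 * x 2 - 2 * x 3 = 0 := pow_eq_zero_iff two_ne_zero |>.1 (by linarith)
  have f4 : 2 * x 7 - x 6 = 0 := pow_eq_zero_iff two_ne_zero |>.1 (by linarith)
  have f5 : 3 * x 6 - 2 * x 5 = 0 := pow_eq_zero_iff two_ne_zero |>.1 (by linarith)
  have f6 : 4 * x 5 - 3 * x 4 = 0 := pow_eq_zero_iff two_ne_zero |>.1 (by linarith)
  have f7 : 5 * x 4 - 4 * x 3 = 0 := pow_eq_zero_iff two_ne_zero |>.1 (by linarith)
  have f8 : x 3 = 0 := pow_eq_zero_iff two_ne_zero |>.1 (by linarith)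
  ext k
  fin_cases k <;> simp <;> omega

theorem halfNorm_two_smul (x : Lattice) : halfNorm ((2 : ℤ) • x) = 4 * halfNorm x := by
  simp only [halfNorm, Pi.smul_apply, smul_eq_mul]; ring

theorem halfNorm_neg (x : Lattice) : halfNorm (-x) = halfNorm x := by
  simp only [halfNorm, Pi.neg_apply]; ring

theorem inner_comm (x y : Lattice) : inner x y = inner y x := by
  rw [inner_eq, inner_eq]; ring

theorem halfNorm_of_mem_Aut {g : Lattice ≃ₗ[ℤ] Lattice} (hg : g ∈ Aut) (x : Lattice) :
    halfNorm (g x) = halfNorm x := by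
  rw [halfNorm_eq, halfNorm_eq, hg]

theorem mk_eq_mk {x y : Lattice} :
    (Submodule.Quotient.mk x : Mod2) = Submodule.Quotient.mk y ↔
      ∃ c : Lattice, x = y + (2 : ℤ) • c := by
  rw [Submodule.Quotient.eq, mem_two]
  exact exists_congr fun c => ⟨fun h => by rw [h]; abel, fun h => by rw [h]; abel⟩

theorem mk_neg_eq (x : Lattice) :
    (Submodule.Quotient.mk (-x) : Mod2) = Submodule.Quotient.mk x :=
  mk_eq_mk.2 ⟨-x, by rw [two_smul]; abel⟩

/-- Two roots that agree modulo `2 E₈` agree up to sign, because `(r - s) / 2` is a lattice vector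
of half norm at most `1`, with equality only for `s = -r`. -/
theorem eq_or_eq_neg_of_mk_eq {r s : Lattice} (hr : halfNorm r = 1) (hs : halfNorm s = 1)
    (h : (Submodule.Quotient.mk r : Mod2) = Submodule.Quotient.mk s) : r = s ∨ r = -s := by
  obtain ⟨c, hc⟩ := mk_eq_mk.1 h
  have h1 := halfNorm_add r (-s)
  have h2 := halfNorm_add r s
  rw [map_neg, halfNorm_neg] at h1
  have h3 : halfNorm (r + -s) = 4 * halfNorm c := by
    rw [← halfNorm_two_smul]; congr 1; rw [hc]; abel
  have h4 := halfNorm_nonneg (r + s)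
  have h5 := halfNorm_nonneg c
  by_cases h6 : halfNorm c ≤ 0
  · left
    rw [hc, eq_zero_of_halfNorm_nonpos h6]; simp
  · right
    exact eq_neg_of_add_eq_zero_left (eq_zero_of_halfNorm_nonpos (by omega))

/-- The inner product of two roots that are different modulo `2 E₈` is `0` or `±1`. -/
theorem abs_inner_le_one {r s : Lattice} (hr : halfNorm r = 1) (hs : halfNorm s = 1)
    (h : (Submodule.Quotient.mk r : Mod2) ≠ Submodule.Quotient.mk s) : |inner r s| ≤ 1 := by
  have h1 := halfNorm_add r (-s)
  have h2 := halfNorm_add r s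
  rw [map_neg, halfNorm_neg] at h1
  have h3 : 0 < halfNorm (r + -s) := by
    by_contra h4
    have := eq_zero_of_halfNorm_nonpos (not_lt.1 h4)
    exact h (by rw [← sub_eq_zero.1 ((sub_eq_add_neg r s).trans this)])
  have h4 : 0 < halfNorm (r + s) := by
    by_contra h4
    have := eq_zero_of_halfNorm_nonpos (not_lt.1 h4)
    exact h (by rw [eq_neg_of_add_eq_zero_left this, mk_neg_eq])
  rw [abs_le]; constructor <;> omega

/-- The 120 positive roots; the decimal digits are the coordinates in the base of simple roots. -/
def positiveRoots : List ℕ :=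
  [1, 10, 11, 100, 110, 111, 1000, 1100, 1110, 1111, 10000, 11000, 11100, 11110, 11111, 100000,
    110000, 111000, 111100, 111110, 111111, 1000000, 1010000, 1011000, 1011100, 1011110, 1011111,
    1110000, 1111000, 1111100, 1111110, 1111111, 1121000, 1121100, 1121110, 1121111, 1122100,
    1122110, 1122111, 1122210, 1122211, 1122221, 10000000, 10100000, 10110000, 10111000, 10111100,
    10111110, 10111111, 11110000, 11111000, 11111100, 11111110, 11111111, 11121000, 11121100,
    11121110, 11121111, 11122100, 11122110, 11122111, 11122210, 11122211, 11122221, 11221000,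
    11221100, 11221110, 11221111, 11222100, 11222110, 11222111, 11222210, 11222211, 11222221,
    11232100, 11232110, 11232111, 11232210, 11232211, 11232221, 11233210, 11233211, 11233221,
    11233321, 12232100, 12232110, 12232111, 12232210, 12232211, 12232221, 12233210, 12233211,
    12233221, 12233321, 12243210, 12243211, 12243221, 12243321, 12244321, 12343210, 12343211,
    12343221, 12343321, 12344321, 12354321, 13354321, 22343210, 22343211, 22343221, 22343321,
    22344321, 22354321, 22454321, 23354321, 23454321, 23464321, 23465321, 23465421, 23465431,
    23465432]

/-- The lattice vector whose coordinates are the decimal digits of `n`. -/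
def ofDigits (n : ℕ) : Lattice := fun k => ((n / 10 ^ (7 - k.val) % 10 : ℕ) : ℤ)

theorem halfNorm_ofDigits : ∀ n ∈ positiveRoots, halfNorm (ofDigits n) = 1 := by
  decide +kernel

/-- Every odd class modulo `2 E₈`, given by the parities of the coordinates, contains a root. -/
theorem exists_positiveRoot_parity : ∀ b₀ b₁ b₂ b₃ b₄ b₅ b₆ b₇ : Fin 2,
    halfNorm (fun k => ((![b₀, b₁, b₂, b₃, b₄, b₅, b₆, b₇] k).val : ℤ)) % 2 = 1 →
      ∃ n ∈ positiveRoots, ∀ k,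
        ofDigits n k % 2 = ((![b₀, b₁, b₂, b₃, b₄, b₅, b₆, b₇] k).val : ℤ) := by
  decide +kernel

/-! ### Reduction modulo 2 -/

theorem Q_mk_eq (x : Lattice) : Q (Submodule.Quotient.mk x) = ((halfNorm x : ℤ) : ZMod 2) := by
  rw [Q_mk, halfNorm_eq]

theorem polar_Q_mk (x y : Lattice) :
    QuadraticMap.polar Q (Submodule.Quotient.mk x) (Submodule.Quotient.mk y) =
      ((inner x y : ℤ) : ZMod 2) :=
  polar_qFun_mk x y

/-- Every nonsingular vector of `E₈ / 2 E₈` is the class of a root. -/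
theorem exists_root_of_Q_eq_one {v : Mod2} (hv : Q v = 1) :
    ∃ r : Lattice, halfNorm r = 1 ∧ Submodule.Quotient.mk r = v := by
  obtain ⟨x, rfl⟩ := Submodule.Quotient.mk_surjective two v
  have hm : ∀ k, ∃ b : Fin 2, (b.val : ℤ) = x k % 2 := fun k =>
    ⟨⟨(x k % 2).toNat, by omega⟩, by simp; omega⟩
  choose b hb using hm
  have hf : ![b 0, b 1, b 2, b 3, b 4, b 5, b 6, b 7] = b := by
    ext k; fin_cases k <;> rfl
  set y : Lattice := fun k => ((b k).val : ℤ) with hy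
  have hxy : (Submodule.Quotient.mk y : Mod2) = Submodule.Quotient.mk x :=
    mk_eq_mk.2 ⟨fun k => - (x k / 2), by
      ext k; simp only [hy, hb, Pi.add_apply, Pi.smul_apply, smul_eq_mul]; omega⟩
  rw [← hxy, Q_mk_eq] at hv
  have hodd : halfNorm y % 2 = 1 := by
    rcases Int.emod_two_eq_zero_or_one (halfNorm y) with h | h
    · rw [(ZMod.intCast_zmod_eq_zero_iff_dvd _ 2).2
        (by exact_mod_cast Int.dvd_of_emod_eq_zero h)] at hv
      exact absurd hv (by decide)
    · exact h
  obtain ⟨n, hn, h⟩ := exists_positiveRoot_parity (b 0) (b 1) (b 2) (b 3) (b 4) (b 5) (b 6) (b 7)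
    (by rw [hf]; exact hodd)
  rw [hf] at h
  refine ⟨ofDigits n, halfNorm_ofDigits n hn, ?_⟩
  rw [← hxy]
  refine mk_eq_mk.2 ⟨fun k => ofDigits n k / 2, ?_⟩
  ext k
  have := h k
  simp only [hy, Pi.add_apply, Pi.smul_apply, smul_eq_mul]; omega

/-- The `k`-th simple root. -/
abbrev simpleRoot (k : Fin 8) : Lattice := Pi.single k 1

theorem inner_simpleRoot (i j : Fin 8) :
    inner (simpleRoot i) (simpleRoot j) = CartanMatrix.E₈ i j := by
  rw [inner, Matrix.toBilin'_single]

theorem halfNorm_simpleRoot (k : Fin 8) : halfNorm (simpleRoot k) = 1 := by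
  have h := inner_self (simpleRoot k)
  rw [inner_simpleRoot, CartanMatrix.E₈_diag] at h
  omega

theorem mk_simpleRoot_ne {i j : Fin 8} (hij : i ≠ j) :
    (Submodule.Quotient.mk (simpleRoot i) : Mod2) ≠ Submodule.Quotient.mk (simpleRoot j) := by
  intro h
  obtain ⟨c, hc⟩ := mk_eq_mk.1 h
  have := congrFun hc i
  simp [hij] at this
  omega

theorem mod2_linearMap_ext {M : Type*} [AddCommGroup M] [Module (ZMod 2) M]
    {f g : Mod2 →ₗ[ZMod 2] M}
    (h : ∀ k, f (Submodule.Quotient.mk (simpleRoot k)) =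
      g (Submodule.Quotient.mk (simpleRoot k))) : f = g := by
  let lift (f : Mod2 →ₗ[ZMod 2] M) : Lattice →ₗ[ℤ] M :=
    (f.toAddMonoidHom.comp (two.mkQ : Lattice →ₗ[ℤ] Mod2).toAddMonoidHom).toIntLinearMap
  have key : lift f = lift g := by
    refine (Pi.basisFun ℤ (Fin 8)).ext fun k => ?_
    rw [Pi.basisFun_apply]
    exact h k
  refine LinearMap.ext fun x => ?_
  obtain ⟨x, rfl⟩ := Submodule.Quotient.mk_surjective two x
  exact LinearMap.congr_fun key x

/-- It suffices to check on simple roots that a linear map preserves the inner product. -/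
theorem inner_ext {f : Lattice →ₗ[ℤ] Lattice}
    (h : ∀ i j, inner (f (simpleRoot i)) (f (simpleRoot j)) = CartanMatrix.E₈ i j)
    (x y : Lattice) : inner (f x) (f y) = inner x y := by
  have : inner.compl₁₂ f f = inner := by
    refine LinearMap.BilinForm.ext_basis (Pi.basisFun ℤ (Fin 8)) fun i j => ?_
    rw [Pi.basisFun_apply, Pi.basisFun_apply]
    exact (h i j).trans (inner_simpleRoot i j).symm
  exact LinearMap.congr_fun₂ this x y

/-- A linear endomorphism of the lattice that preserves the inner product is an automorphism,
because the Gram matrix is unimodular. -/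
theorem exists_mem_Aut_of_inner {f : Lattice →ₗ[ℤ] Lattice}
    (h : ∀ i j, inner (f (simpleRoot i)) (f (simpleRoot j)) = CartanMatrix.E₈ i j) :
    ∃ g ∈ Aut, ∀ x, g x = f x := by
  have hx := inner_ext h
  have hB : ((LinearMap.toMatrix' f)ᵀ * CartanMatrix.E₈ * LinearMap.toMatrix' f) =
      CartanMatrix.E₈ := by
    ext i j
    have h1 := h i j
    rw [inner, Matrix.toBilin'_apply'] at h1
    rw [← h1, Matrix.mul_assoc, Matrix.mul_apply]
    simp only [dotProduct, transpose_apply, LinearMap.toMatrix'_apply, Matrix.mul_apply, mulVec]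
  have hdet : IsUnit (LinearMap.toMatrix' f).det := by
    have h2 := congrArg Matrix.det hB
    rw [det_mul, det_mul, det_transpose, CartanMatrix.E₈_det, mul_one] at h2
    exact IsUnit.of_mul_eq_one _ h2
  refine ⟨LinearEquiv.ofIsUnitDet (f := f) (v := Pi.basisFun ℤ (Fin 8))
    (v' := Pi.basisFun ℤ (Fin 8)) ?_, ?_, fun x => rfl⟩
  · rw [LinearMap.toMatrix_eq_toMatrix']; exact hdet
  · intro x y; exact hx x y

theorem reduction_mem_orthogonalGroup {g : Lattice ≃ₗ[ℤ] Lattice} (hg : g ∈ Aut) :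
    reduction g ∈ orthogonalGroup := by
  intro x
  obtain ⟨x, rfl⟩ := Submodule.Quotient.mk_surjective two x
  rw [reduction_mk, Q_mk_eq, Q_mk_eq, halfNorm_of_mem_Aut hg]

theorem polar_of_mem_orthogonalGroup {g : Mod2 ≃ₗ[ZMod 2] Mod2} (hg : g ∈ orthogonalGroup)
    (x y : Mod2) : QuadraticMap.polar Q (g x) (g y) = QuadraticMap.polar Q x y := by
  have h : ∀ z, Q (g z) = Q z := hg
  rw [QuadraticMap.polar, QuadraticMap.polar, ← map_add, h, h, h]

/-- Signs along the edges of a tree can be prescribed by signs at the vertices; here for the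
Dynkin diagram of type `E₈`. -/
theorem exists_signs (c : Fin 8 → Fin 8 → ℤ) (hsymm : ∀ i j, c i j = c j i)
    (hdiag : ∀ i, c i i = 2)
    (hoff : ∀ i j, i ≠ j → |c i j| ≤ 1)
    (hmod : ∀ i j, (2 : ℤ) ∣ c i j - CartanMatrix.E₈ i j) :
    ∃ s : Fin 8 → ℤ, (∀ i, s i = 1 ∨ s i = -1) ∧
      ∀ i j, s i * s j * c i j = CartanMatrix.E₈ i j := by
  have hz : ∀ i j, i ≠ j → CartanMatrix.E₈ i j = 0 → c i j = 0 := by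
    intro i j hij h0
    have h1 := abs_le.1 (hoff i j hij)
    have h2 := hmod i j
    rw [h0] at h2; omega
  have ho : ∀ i j, i ≠ j → CartanMatrix.E₈ i j = -1 → c i j = 1 ∨ c i j = -1 := by
    intro i j hij h0
    have h1 := abs_le.1 (hoff i j hij)
    have h2 := hmod i j
    rw [h0] at h2; omega
  -- extending the choice of signs along an edge
  have step : ∀ i j, i ≠ j → CartanMatrix.E₈ i j = -1 → ∀ a : ℤ, (a = 1 ∨ a = -1) →
      ∃ b : ℤ, (b = 1 ∨ b = -1) ∧ a * b * c i j = -1 := by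
    intro i j hij h0 a ha
    rcases ho i j hij h0 with h | h <;> rcases ha with rfl | rfl <;> rw [h]
    exacts [⟨-1, by decide⟩, ⟨1, by decide⟩, ⟨1, by decide⟩, ⟨-1, by decide⟩]
  obtain ⟨s2, h2, e32⟩ := step 3 2 (by decide) (by decide) 1 (Or.inl rfl)
  obtain ⟨s1, h1, e31⟩ := step 3 1 (by decide) (by decide) 1 (Or.inl rfl)
  obtain ⟨s0, h0, e20⟩ := step 2 0 (by decide) (by decide) s2 h2
  obtain ⟨s4, h4, e34⟩ := step 3 4 (by decide) (by decide) 1 (Or.inl rfl)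
  obtain ⟨s5, h5, e45⟩ := step 4 5 (by decide) (by decide) s4 h4
  obtain ⟨s6, h6, e56⟩ := step 5 6 (by decide) (by decide) s5 h5
  obtain ⟨s7, h7, e67⟩ := step 6 7 (by decide) (by decide) s6 h6
  have hs : ∀ i, ![s0, s1, s2, 1, s4, s5, s6, s7] i = 1 ∨
      ![s0, s1, s2, 1, s4, s5, s6, s7] i = -1 := by
    intro i; fin_cases i
    exacts [h0, h1, h2, Or.inl rfl, h4, h5, h6, h7]
  refine ⟨![s0, s1, s2, 1, s4, s5, s6, s7], hs, fun i j => ?_⟩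
  have hcases : ∀ i j, i = j ∨ CartanMatrix.E₈ i j = 0 ∨ CartanMatrix.E₈ i j = -1 := by
    intro i j; fin_cases i <;> fin_cases j <;> decide
  have hcases' : ∀ i j, CartanMatrix.E₈ i j = -1 →
      (i, j) ∈ [((3, 2) : Fin 8 × Fin 8), (3, 1), (2, 0), (3, 4), (4, 5), (5, 6), (6, 7)] ∨
      (j, i) ∈ [((3, 2) : Fin 8 × Fin 8), (3, 1), (2, 0), (3, 4), (4, 5), (5, 6), (6, 7)] := by
    intro i j; fin_cases i <;> fin_cases j <;> decide
  have hedge : ∀ i j,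
      (i, j) ∈ [((3, 2) : Fin 8 × Fin 8), (3, 1), (2, 0), (3, 4), (4, 5), (5, 6), (6, 7)] →
      ![s0, s1, s2, 1, s4, s5, s6, s7] i * ![s0, s1, s2, 1, s4, s5, s6, s7] j * c i j =
        CartanMatrix.E₈ i j := by
    intro i j h
    simp only [List.mem_cons, Prod.mk.injEq, List.not_mem_nil, or_false] at h
    rcases h with ⟨rfl, rfl⟩ | ⟨rfl, rfl⟩ | ⟨rfl, rfl⟩ | ⟨rfl, rfl⟩ | ⟨rfl, rfl⟩ | ⟨rfl, rfl⟩ |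
      ⟨rfl, rfl⟩
    exacts [e32, e31, e20, e34, e45, e56, e67]
  rcases eq_or_ne i j with rfl | hij
  · rw [hdiag, CartanMatrix.E₈_diag]
    rcases hs i with h | h <;> rw [h] <;> rfl
  · rcases hcases i j with h | h | h
    · exact absurd h hij
    · rw [hz i j hij h, h, mul_zero]
    rcases hcases' i j h with h | h
    · exact hedge i j h
    · rw [hsymm, mul_comm (_ : ℤ) (_ : ℤ), mul_comm (Matrix.vecCons _ _ i), mul_comm, hedge j i h]
      exact CartanMatrix.E₈_isSymm.apply i j

/-- Reduction modulo 2 maps `Aut(E₈)` onto the orthogonal group of `E₈ / 2 E₈`: the images of the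
simple roots lift to roots, and the signs of these can be chosen so that their Gram matrix is the
Cartan matrix. -/
theorem exists_reduction_eq {g : Mod2 ≃ₗ[ZMod 2] Mod2} (hg : g ∈ orthogonalGroup) :
    ∃ h ∈ Aut, reduction h = g := by
  have hQ : ∀ z, Q (g z) = Q z := hg
  have hr : ∀ k, ∃ r : Lattice, halfNorm r = 1 ∧
      Submodule.Quotient.mk r = g (Submodule.Quotient.mk (simpleRoot k)) := fun k =>
    exists_root_of_Q_eq_one (by rw [hQ, Q_mk_eq, halfNorm_simpleRoot]; rfl)
  choose r hr1 hr2 using hr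
  obtain ⟨s, hs, hsc⟩ := exists_signs (fun i j => inner (r i) (r j))
    (fun i j => inner_comm _ _) (fun i => by simp [inner_self, hr1])
    (fun i j hij => abs_inner_le_one (hr1 i) (hr1 j) (by
      rw [hr2, hr2]; exact fun h => mk_simpleRoot_ne hij (g.injective h)))
    (fun i j => by
      have h1 := polar_of_mem_orthogonalGroup hg (Submodule.Quotient.mk (simpleRoot i))
        (Submodule.Quotient.mk (simpleRoot j))
      rw [← hr2, ← hr2, polar_Q_mk, polar_Q_mk, inner_simpleRoot,
        ZMod.intCast_eq_intCast_iff_dvd_sub] at h1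
      have := dvd_neg.2 h1
      simpa using this)
  obtain ⟨h, hA, hf⟩ := exists_mem_Aut_of_inner
    (f := (Pi.basisFun ℤ (Fin 8)).constr ℤ fun k => s k • r k) (fun i j => by
      have e : ∀ k, ((Pi.basisFun ℤ (Fin 8)).constr ℤ fun k => s k • r k) (simpleRoot k) =
          s k • r k := fun k => by
        rw [simpleRoot, ← Pi.basisFun_apply, Module.Basis.constr_basis]
      rw [e, e, ← hsc i j, map_smul, map_smul, LinearMap.smul_apply, smul_eq_mul, smul_eq_mul]
      ring)
  refine ⟨h, hA, ?_⟩
  have key : (reduction h : Mod2 →ₗ[ZMod 2] Mod2) = g := by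
    refine mod2_linearMap_ext fun k => ?_
    have e : h (simpleRoot k) = s k • r k := by
      rw [hf, simpleRoot, ← Pi.basisFun_apply, Module.Basis.constr_basis]
    change reduction h _ = g _
    rw [reduction_mk, e, ← hr2]
    rcases hs k with h1 | h1 <;> rw [h1]
    · rw [one_smul]
    · rw [neg_one_smul, mk_neg_eq]
  exact LinearEquiv.toLinearMap_injective key

theorem lattice_linearMap_ext {f g : Lattice →ₗ[ℤ] Lattice}
    (h : ∀ k, f (simpleRoot k) = g (simpleRoot k)) : f = g :=
  (Pi.basisFun ℤ (Fin 8)).ext fun k => by rw [Pi.basisFun_apply]; exact h k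

theorem reduction_neg : reduction (LinearEquiv.neg ℤ) = 1 := by
  refine LinearEquiv.ext fun x => ?_
  obtain ⟨x, rfl⟩ := Submodule.Quotient.mk_surjective two x
  exact mk_neg_eq x

/-- The kernel of the reduction modulo 2 on `Aut(E₈)` is `±1`. -/
theorem eq_one_or_neg_of_reduction_eq_one {h : Lattice ≃ₗ[ℤ] Lattice} (hA : h ∈ Aut)
    (h1 : reduction h = 1) : h = 1 ∨ h = LinearEquiv.neg ℤ := by
  have hpm : ∀ k, h (simpleRoot k) = simpleRoot k ∨ h (simpleRoot k) = -simpleRoot k := fun k =>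
    eq_or_eq_neg_of_mk_eq (by rw [halfNorm_of_mem_Aut hA, halfNorm_simpleRoot])
      (halfNorm_simpleRoot k) (by rw [← reduction_mk, h1]; rfl)
  have hs : ∀ k, ∃ s : ℤ, (s = 1 ∨ s = -1) ∧ h (simpleRoot k) = s • simpleRoot k := fun k => by
    rcases hpm k with e | e
    · exact ⟨1, Or.inl rfl, by rw [e, one_smul]⟩
    · exact ⟨-1, Or.inr rfl, by rw [e, neg_one_smul]⟩
  choose s hs1 hs2 using hs
  -- the sign is constant along the edges of the diagram
  have hedge : ∀ i j, CartanMatrix.E₈ i j = -1 → s i = s j := by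
    intro i j hij
    have := hA (simpleRoot i) (simpleRoot j)
    rw [hs2, hs2, map_smul, map_smul, LinearMap.smul_apply, inner_simpleRoot, hij] at this
    rcases hs1 i with e | e <;> rcases hs1 j with e' | e' <;> rw [e, e'] at this ⊢ <;>
      simp at this
  have hall : ∀ k, s k = s 3 := by
    have e0 := hedge 0 2 (by decide)
    have e1 := hedge 1 3 (by decide)
    have e2 := hedge 2 3 (by decide)
    have e3 := hedge 3 4 (by decide)
    have e4 := hedge 4 5 (by decide)
    have e5 := hedge 5 6 (by decide)
    have e6 := hedge 6 7 (by decide)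
    intro k; fin_cases k <;> simp only [Fin.zero_eta, Fin.mk_one, Fin.reduceFinMk] <;> omega
  rcases hs1 3 with e | e
  · left
    refine LinearEquiv.toLinearMap_injective (lattice_linearMap_ext fun k => ?_)
    change h _ = simpleRoot k
    rw [hs2, hall, e, one_smul]
  · right
    refine LinearEquiv.toLinearMap_injective (lattice_linearMap_ext fun k => ?_)
    change h _ = -simpleRoot k
    rw [hs2, hall, e, neg_one_smul]

/-! ### The hyperbolic model -/

/-- The underlying space of the hyperbolic quadratic space `𝔽₂⁴ ⊕ 𝔽₂⁴`. -/
abbrev Model : Type := (Fin 4 → ZMod 2) × (Fin 4 → ZMod 2)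

/-- The hyperbolic form `(y, x) ↦ y · x`. -/
def modelForm (p : Model) : ZMod 2 := p.1 ⬝ᵥ p.2

theorem modelForm_add (p q : Model) :
    modelForm (p + q) = modelForm p + modelForm q + (p.1 ⬝ᵥ q.2 + q.1 ⬝ᵥ p.2) := by
  simp only [modelForm, Prod.fst_add, Prod.snd_add, add_dotProduct, dotProduct_add]
  ring

theorem modelForm_nondegenerate {p : Model}
    (hp : ∀ q, modelForm (p + q) = modelForm p + modelForm q) : p = 0 := by
  have h : ∀ q : Model, p.1 ⬝ᵥ q.2 + q.1 ⬝ᵥ p.2 = 0 := fun q => by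
    have := hp q
    rwa [modelForm_add, add_eq_left] at this
  refine Prod.ext (funext fun i => ?_) (funext fun i => ?_)
  · simpa using h (0, Pi.single i 1)
  · simpa using h (Pi.single i 1, 0)

/-- The coordinates of a vector of `E₈ / 2 E₈` in a hyperbolic basis. -/
def coordFun : Lattice →+ Model where
  toFun x := (![x 5, x 2 + x 6, x 0 + x 3 + x 5 + x 6 + x 7, x 1 + x 2 + x 3 + x 4 + x 6],
    ![x 4, x 0, x 0 + x 3 + x 5 + x 7, x 1 + x 2 + x 4 + x 6])
  map_zero' := by ext i <;> fin_cases i <;> simp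
  map_add' x y := by ext i <;> fin_cases i <;> simp <;> ring

/-- The coordinates in a hyperbolic basis, as a linear map on `E₈ / 2 E₈`. -/
def coordMap : Mod2 →ₗ[ZMod 2] Model :=
  (two.liftQ coordFun.toIntLinearMap (by
    rintro _ ⟨x, rfl⟩
    change coordFun ((2 : ℤ) • x) = 0
    rw [map_zsmul]
    ext i <;> simp [show (2 : ZMod 2) = 0 from rfl])).toAddMonoidHom.toZModLinearMap 2

theorem coordMap_mk (x : Lattice) : coordMap (Submodule.Quotient.mk x) = coordFun x := rfl

theorem modelForm_coordMap (v : Mod2) : modelForm (coordMap v) = Q v := by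
  obtain ⟨x, rfl⟩ := Submodule.Quotient.mk_surjective two v
  have h : ∀ a₀ a₁ a₂ a₃ a₄ a₅ a₆ a₇ : ZMod 2,
      a₅ * a₄ + (a₂ + a₆) * a₀ + (a₀ + a₃ + a₅ + a₆ + a₇) * (a₀ + a₃ + a₅ + a₇)
        + (a₁ + a₂ + a₃ + a₄ + a₆) * (a₁ + a₂ + a₄ + a₆) =
      a₀ ^ 2 + a₁ ^ 2 + a₂ ^ 2 + a₃ ^ 2 + a₄ ^ 2 + a₅ ^ 2 + a₆ ^ 2 + a₇ ^ 2
        - a₀ * a₂ - a₁ * a₃ - a₂ * a₃ - a₃ * a₄ - a₄ * a₅ - a₅ * a₆ - a₆ * a₇ := by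
    decide +kernel
  rw [coordMap_mk, Q_mk_eq, halfNorm]
  push_cast
  rw [← h]
  simp [modelForm, coordFun, dotProduct, Fin.sum_univ_four]

theorem coordMap_injective : Function.Injective coordMap := by
  rw [← LinearMap.ker_eq_bot, LinearMap.ker_eq_bot']
  intro v hv
  obtain ⟨x, rfl⟩ := Submodule.Quotient.mk_surjective two v
  rw [coordMap_mk] at hv
  have h1 := congrArg Prod.fst hv
  have h2 := congrArg Prod.snd hv
  have a0 := congrFun h1 0
  have a1 := congrFun h1 1
  have a2 := congrFun h1 2
  have a3 := congrFun h1 3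
  have b0 := congrFun h2 0
  have b1 := congrFun h2 1
  have b2 := congrFun h2 2
  have b3 := congrFun h2 3
  simp only [coordFun, AddMonoidHom.coe_mk, ZeroHom.coe_mk, cons_val, Prod.fst_zero,
    Prod.snd_zero, Pi.zero_apply] at a0 a1 a2 a3 b0 b1 b2 b3
  norm_cast at a0 a1 a2 a3 b0 b1 b2 b3
  rw [ZMod.intCast_zmod_eq_zero_iff_dvd] at a0 a1 a2 a3 b0 b1 b2 b3
  refine (Submodule.Quotient.mk_eq_zero two).2 (mem_two.2 ⟨fun k => x k / 2, ?_⟩)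
  ext k
  simp only [Pi.smul_apply, smul_eq_mul]
  refine Int.mul_ediv_cancel' ?_
  push_cast at a0 a1 a2 a3 b0 b1 b2 b3
  fin_cases k <;> simp only [Fin.zero_eta, Fin.mk_one, Fin.reduceFinMk] <;> omega

theorem coordMap_surjective : Function.Surjective coordMap := by
  intro p
  let z : Fin 8 → ZMod 2 := ![p.2 1, p.1 1 + p.2 0 + p.2 3, p.1 1 + p.1 2 + p.2 2,
    p.1 3 + p.2 3, p.2 0, p.1 0, p.1 2 + p.2 2, p.1 0 + p.1 3 + p.2 1 + p.2 2 + p.2 3]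
  -- the inverse of the coordinate map, lifted to the integers
  refine ⟨Submodule.Quotient.mk fun k => ((z k).val : ℤ), ?_⟩
  rw [coordMap_mk]
  simp only [coordFun, AddMonoidHom.coe_mk, ZeroHom.coe_mk,
    ZMod.natCast_val]
  have h2 : (2 : ZMod 2) = 0 := rfl
  ext i <;> fin_cases i <;> simp [z] <;> ring_nf <;> simp [h2]

/-- An explicit isometry of `E₈ / 2 E₈` with the hyperbolic model. -/
noncomputable def coordEquiv : Mod2 ≃ₗ[ZMod 2] Model :=
  LinearEquiv.ofBijective coordMap ⟨coordMap_injective, coordMap_surjective⟩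

theorem modelForm_coordEquiv (v : Mod2) : modelForm (coordEquiv v) = Q v := modelForm_coordMap v

instance : Module.Finite (ZMod 2) Mod2 := Module.Finite.equiv coordEquiv.symm

theorem finrank_mod2 : Module.finrank (ZMod 2) Mod2 = 8 := by
  rw [coordEquiv.finrank_eq]; simp

theorem ncard_isotropicPoints : isotropicPoints.ncard = 135 := by
  have h : isotropicPoints = coordEquiv ⁻¹' {p | p ≠ 0 ∧ modelForm p = 0} := by
    ext v
    simp [isotropicPoints, modelForm_coordEquiv]
  rw [h, Set.ncard_preimage_of_injective_subset_range coordEquiv.injective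
    (by rw [coordEquiv.surjective.range_eq]; exact Set.subset_univ _)]
  have e : {p : Model | p ≠ 0 ∧ modelForm p = 0} =
      ↑(Finset.univ.filter fun p : Model => p ≠ 0 ∧ p.1 ⬝ᵥ p.2 = 0) := by
    ext p; simp [modelForm]
  rw [e, Set.ncard_coe_finset]
  decide +kernel

theorem nonempty_isometryEquiv :
    Nonempty (Q.IsometryEquiv (QuadraticForm.dualProd (ZMod 2) (Fin 4 → ZMod 2))) := by
  refine ⟨⟨coordEquiv.trans ((Pi.basisFun (ZMod 2) (Fin 4)).toDualEquiv.prodCongr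
    (LinearEquiv.refl _ _)), fun v => ?_⟩⟩
  rw [← modelForm_coordEquiv]
  change ((Pi.basisFun (ZMod 2) (Fin 4)).toDual (coordEquiv v).1) (coordEquiv v).2 = _
  generalize coordEquiv v = p
  rw [modelForm, dotProduct]
  conv_lhs => rw [← (Pi.basisFun (ZMod 2) (Fin 4)).sum_repr p.2]
  rw [map_sum]
  refine Finset.sum_congr rfl fun i _ => ?_
  rw [map_smul, Module.Basis.toDual_apply_left, smul_eq_mul, mul_comm]
  simp

/-! ### Pairs of disjoint isotropic 4-spaces -/

theorem polar_eq_zero_of_isotropic {W : Submodule (ZMod 2) Mod2} (hW : ∀ v ∈ W, Q v = 0)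
    {v w : Mod2} (hv : v ∈ W) (hw : w ∈ W) : QuadraticMap.polar Q v w = 0 := by
  rw [QuadraticMap.polar, hW _ (W.add_mem hv hw), hW _ hv, hW _ hw]; simp

/-- The polar form of `Q` is nondegenerate. -/
theorem eq_zero_of_polar_eq_zero {v : Mod2} (h : ∀ w, QuadraticMap.polar Q v w = 0) : v = 0 := by
  rw [← coordEquiv.map_eq_zero_iff]
  refine modelForm_nondegenerate fun q => ?_
  obtain ⟨w, rfl⟩ := coordEquiv.surjective q
  have h1 := h w
  rw [QuadraticMap.polar, sub_sub, sub_eq_zero] at h1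
  rw [← map_add, modelForm_coordEquiv, modelForm_coordEquiv, modelForm_coordEquiv, h1]

theorem isCompl_of_disjoint {W₁ W₂ : Submodule (ZMod 2) Mod2} (h₁ : IsIsotropic4Space W₁)
    (h₂ : IsIsotropic4Space W₂) (hd : Disjoint W₁ W₂) : IsCompl W₁ W₂ := by
  refine ⟨hd, codisjoint_iff.2 (Submodule.eq_top_of_finrank_eq ?_)⟩
  have h := Submodule.finrank_sup_add_finrank_inf_eq W₁ W₂
  rw [hd.eq_bot, finrank_bot, h₁.1, h₂.1] at h
  rw [finrank_mod2]; omega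

/-- Two disjoint isotropic 4-spaces are dual to each other, so that an isometry with the hyperbolic
model moves them to the two summands. -/
theorem exists_isometry_of_disjoint {W₁ W₂ : Submodule (ZMod 2) Mod2}
    (h₁ : IsIsotropic4Space W₁) (h₂ : IsIsotropic4Space W₂) (hd : Disjoint W₁ W₂) :
    ∃ Φ : Mod2 ≃ₗ[ZMod 2] Model, (∀ v, modelForm (Φ v) = Q v) ∧
      (∀ v, v ∈ W₁ ↔ (Φ v).2 = 0) ∧ (∀ v, v ∈ W₂ ↔ (Φ v).1 = 0) := by
  have hc := isCompl_of_disjoint h₁ h₂ hd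
  let b : Module.Basis (Fin 4) (ZMod 2) W₂ := Module.finBasisOfFinrankEq _ _ h₂.1
  let L : W₁ →ₗ[ZMod 2] (Fin 4 → ZMod 2) :=
    LinearMap.pi fun i => ((QuadraticMap.polarBilin Q).flip (b i : Mod2)).comp W₁.subtype
  have hL : ∀ w i, L w i = QuadraticMap.polar Q w (b i : Mod2) := fun _ _ => rfl
  -- in terms of `L` and the basis, the polar form is the dot product
  have hL' : ∀ (w : W₁) (u : W₂), QuadraticMap.polar Q (w : Mod2) u = L w ⬝ᵥ b.equivFun u := by
    intro w u
    conv_lhs => rw [← b.sum_equivFun u]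
    change QuadraticMap.polarBilin Q (w : Mod2) _ = _
    rw [Submodule.coe_sum, map_sum]
    refine Finset.sum_congr rfl fun i _ => ?_
    rw [Submodule.coe_smul, map_smul, smul_eq_mul, mul_comm]
    rfl
  have hinj : Function.Injective L := by
    rw [← LinearMap.ker_eq_bot, LinearMap.ker_eq_bot']
    intro w hw
    have : (w : Mod2) = 0 := by
      refine eq_zero_of_polar_eq_zero fun z => ?_
      obtain ⟨u₁, hu₁, u₂, hu₂, rfl⟩ :=
        Submodule.mem_sup.1 (hc.sup_eq_top ▸ Submodule.mem_top (x := z))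
      rw [QuadraticMap.polar_add_right, polar_eq_zero_of_isotropic h₁.2 w.2 hu₁, zero_add,
        hL' w ⟨u₂, hu₂⟩, hw, zero_dotProduct]
    exact Subtype.ext this
  let E : W₁ ≃ₗ[ZMod 2] (Fin 4 → ZMod 2) :=
    LinearEquiv.ofInjectiveOfFinrankEq L hinj (by rw [h₁.1]; simp)
  have hE : ∀ w, E w = L w := fun _ => rfl
  let P := Submodule.prodEquivOfIsCompl W₁ W₂ hc
  refine ⟨P.symm.trans (E.prodCongr b.equivFun), fun v => ?_, fun v => ?_, fun v => ?_⟩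
  · obtain ⟨⟨w, u⟩, rfl⟩ := P.surjective v
    rw [LinearEquiv.trans_apply, P.symm_apply_apply]
    change L w ⬝ᵥ b.equivFun u = Q ((w : Mod2) + u)
    rw [← hL', QuadraticMap.polar, h₁.2 _ w.2, h₂.2 _ u.2]; simp
  · rw [LinearEquiv.trans_apply]
    change _ ↔ b.equivFun (P.symm v).2 = 0
    rw [LinearEquiv.map_eq_zero_iff, Submodule.prodEquivOfIsCompl_symm_apply_snd_eq_zero]
  · rw [LinearEquiv.trans_apply]
    change _ ↔ E (P.symm v).1 = 0
    rw [LinearEquiv.map_eq_zero_iff, Submodule.prodEquivOfIsCompl_symm_apply_fst_eq_zero]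

/-! ### The standard spread of the hyperbolic model -/

/-- The alternating `4 × 4` matrix over `𝔽₂` with the given entries above the diagonal. -/
def altMatrix (a : Fin 6 → ZMod 2) : Matrix (Fin 4) (Fin 4) (ZMod 2) :=
  !![0, a 0, a 1, a 2; a 0, 0, a 3, a 4; a 1, a 3, 0, a 5; a 2, a 4, a 5, 0]

/-- The Pfaffian of `altMatrix a`. -/
def pfaffian (a : Fin 6 → ZMod 2) : ZMod 2 := a 0 * a 5 + a 1 * a 4 + a 2 * a 3

/-- Eight alternating matrices (in the coordinates of `altMatrix`) with nonsingular pairwise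
differences. -/
def kerdock : Fin 8 → Fin 6 → ZMod 2 :=
  ![![0, 0, 0, 0, 0, 0], ![1, 0, 1, 1, 0, 0], ![0, 0, 1, 1, 0, 1], ![1, 1, 1, 1, 1, 1],
    ![1, 1, 0, 0, 0, 1], ![0, 1, 1, 0, 1, 0], ![1, 0, 0, 0, 1, 1], ![0, 1, 0, 1, 1, 0]]

theorem altMatrix_add (a b : Fin 6 → ZMod 2) : altMatrix (a + b) = altMatrix a + altMatrix b := by
  ext i j; fin_cases i <;> fin_cases j <;> simp [altMatrix]

/-- An alternating matrix with trivial kernel has nonzero Pfaffian. -/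
theorem pfaffian_eq_one {a : Fin 6 → ZMod 2} (h : ∀ x, x ≠ 0 → altMatrix a *ᵥ x ≠ 0) :
    pfaffian a = 1 := by
  have key : ∀ a : Fin 6 → ZMod 2, (∀ x, x ≠ 0 → altMatrix a *ᵥ x ≠ 0) → pfaffian a = 1 := by
    decide +kernel
  exact key a h

/-- The vectors `a` for which `a + kerdock c` occurs in the family. -/
def Near (c : Fin 8) (a : Fin 6 → ZMod 2) : Prop := ∃ j, a + kerdock c = kerdock j

instance (c : Fin 8) (a : Fin 6 → ZMod 2) : Decidable (Near c a) := by unfold Near; infer_instance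

/-- For a family that contains `0` and whose pairwise differences have Pfaffian `1`, two further
members `a` and `b` determine a translate of the standard family (by some `kerdock c`) to which
every other member belongs, except possibly `a + b`. -/
theorem exists_near : ∀ a, pfaffian a = 1 → ∀ b, pfaffian b = 1 → pfaffian (a + b) = 1 →
    ∃ c, Near c a ∧ Near c b ∧ ∀ d, pfaffian d = 1 → pfaffian (a + d) = 1 →
      pfaffian (b + d) = 1 → d ≠ a + b → Near c d := by
  decide +kernel

/-- Only scalars intertwine five of the matrices of the standard family. The first of the five is an
involution, so that `P` commutes with its products with the other four, and in the algebra
generated by these there are an element with kernel spanned by `e₀` and elements that move `e₀` to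
the other basis vectors. -/
theorem eq_smul_one_of_intertwines {P R : Matrix (Fin 4) (Fin 4) (ZMod 2)}
    (h : ∀ j, 3 ≤ j → R * altMatrix (kerdock j) = altMatrix (kerdock j) * P) :
    ∃ c : ZMod 2, R = c • 1 ∧ P = c • 1 := by
  set A : Fin 8 → Matrix (Fin 4) (Fin 4) (ZMod 2) := fun j => altMatrix (kerdock j) with hA
  have h33 : A 3 * A 3 = 1 := by decide +kernel
  have hR : R = A 3 * P * A 3 := by
    rw [← h 3 le_rfl, mul_assoc]; exact (congrArg (R * ·) h33).symm ▸ (mul_one R).symm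
  have hcomm : ∀ j, 3 ≤ j → Commute P (A 3 * A j) := fun j hj => by
    have h1 := h j hj
    change R * A j = A j * P at h1
    rw [hR] at h1
    calc P * (A 3 * A j) = (A 3 * A 3) * P * (A 3 * A j) := by rw [h33, one_mul]
      _ = A 3 * (A 3 * P * A 3 * A j) := by simp only [mul_assoc]
      _ = A 3 * A j * P := by rw [h1, mul_assoc]
  have h4 := hcomm 4 (by decide)
  have h5 := hcomm 5 (by decide)
  have h6 := hcomm 6 (by decide)
  have h7 := hcomm 7 (by decide)
  have hmul : ∀ {X}, Commute P X → ∀ v, P *ᵥ (X *ᵥ v) = X *ᵥ (P *ᵥ v) := fun {X} hX v => by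
    rw [mulVec_mulVec, mulVec_mulVec, hX.eq]
  -- an element of the algebra generated by these products whose kernel is spanned by `e₀`
  have hZ : ∀ v, (A 3 * A 5 + A 3 * A 4 * (A 3 * A 6) + A 3 * A 5 * (A 3 * A 7)) *ᵥ v = 0 →
      v = v 0 • Pi.single 0 1 := by decide +kernel
  have h0 : P *ᵥ Pi.single 0 1 = (P *ᵥ Pi.single 0 1) 0 • Pi.single 0 1 := by
    refine hZ _ ?_
    rw [← hmul ((h5.add_right (h4.mul_right h6)).add_right (h5.mul_right h7))]
    have : (A 3 * A 5 + A 3 * A 4 * (A 3 * A 6) + A 3 * A 5 * (A 3 * A 7)) *ᵥ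
        Pi.single 0 1 = 0 := by
      decide +kernel
    rw [this, mulVec_zero]
  set c := (P *ᵥ Pi.single 0 1) 0
  -- the algebra moves `e₀` to the other basis vectors
  have hmove : ∀ {X}, Commute P X → ∀ k, X *ᵥ Pi.single 0 1 = Pi.single k 1 →
      P *ᵥ Pi.single k 1 = c • Pi.single k 1 := fun {X} hX k hk => by
    rw [← hk, hmul hX, h0, mulVec_smul]
  have h1 := hmove (h4.mul_right h5) 1 (by decide +kernel)
  have h2 := hmove (h4.mul_right h6) 2 (by decide +kernel)
  have h3 := hmove (h5.mul_right h7) 3 (by decide +kernel)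
  have hP : P = c • 1 := by
    ext i k
    have : P *ᵥ Pi.single k 1 = c • Pi.single k 1 := by
      fin_cases k
      exacts [h0, h1, h2, h3]
    have := congrFun this i
    simpa [Matrix.one_apply, Pi.single_apply] using this
  refine ⟨c, ?_, hP⟩
  rw [hR, hP]
  simp [h33]

/-- The standard spread: the first summand, and the graphs of the alternating matrices in the family
`kerdock`. -/
def stdSpread : Fin 9 → Submodule (ZMod 2) Model :=
  Fin.cases (LinearMap.ker (LinearMap.snd _ _ _)) fun k =>
    LinearMap.ker (LinearMap.fst _ _ _ -
      (altMatrix (kerdock k)).mulVecLin.comp (LinearMap.snd _ _ _))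

theorem mem_stdSpread_zero {p : Model} : p ∈ stdSpread 0 ↔ p.2 = 0 := Iff.rfl

theorem mem_stdSpread_succ {k : Fin 8} {p : Model} :
    p ∈ stdSpread k.succ ↔ p.1 = altMatrix (kerdock k) *ᵥ p.2 := by
  change p.1 - altMatrix (kerdock k) *ᵥ p.2 = 0 ↔ _
  rw [sub_eq_zero]

instance (i : Fin 9) (p : Model) : Decidable (p ∈ stdSpread i) :=
  Fin.cases (motive := fun i => Decidable (p ∈ stdSpread i))
    (decidable_of_iff _ mem_stdSpread_zero.symm)
    (fun _ => decidable_of_iff _ mem_stdSpread_succ.symm) i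

theorem altMatrix_dotProduct (a : Fin 6 → ZMod 2) (x : Fin 4 → ZMod 2) :
    altMatrix a *ᵥ x ⬝ᵥ x = 0 := by
  have h2 : (2 : ZMod 2) = 0 := rfl
  simp [altMatrix, mulVec, dotProduct, Fin.sum_univ_four]
  ring_nf
  simp [h2]

theorem modelForm_eq_zero_of_mem {i : Fin 9} {p : Model} (hp : p ∈ stdSpread i) :
    modelForm p = 0 := by
  induction i using Fin.cases with
  | zero => rw [modelForm, mem_stdSpread_zero.1 hp, dotProduct_zero]
  | succ k => rw [modelForm, mem_stdSpread_succ.1 hp, altMatrix_dotProduct]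

theorem disjoint_stdSpread {i j : Fin 9} (hij : i ≠ j) : Disjoint (stdSpread i) (stdSpread j) := by
  have key : ∀ k l : Fin 8, k ≠ l → ∀ x : Fin 4 → ZMod 2,
      altMatrix (kerdock k) *ᵥ x = altMatrix (kerdock l) *ᵥ x → x = 0 := by
    decide +kernel
  rw [Submodule.disjoint_def]
  intro p hi hj
  suffices p.2 = 0 by
    induction i using Fin.cases with
    | zero =>
      induction j using Fin.cases with
      | zero => exact absurd rfl hij
      | succ l => exact Prod.ext (by rw [mem_stdSpread_succ.1 hj, this, mulVec_zero]; rfl) this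
    | succ k => exact Prod.ext (by rw [mem_stdSpread_succ.1 hi, this, mulVec_zero]; rfl) this
  induction i using Fin.cases with
  | zero => exact hi
  | succ k =>
    induction j using Fin.cases with
    | zero => exact hj
    | succ l =>
      refine key k l (fun h => hij (by rw [h])) p.2 ?_
      rw [← mem_stdSpread_succ.1 hi, ← mem_stdSpread_succ.1 hj]

theorem exists_mem_stdSpread {p : Model} (hp : modelForm p = 0) : ∃ i, p ∈ stdSpread i := by
  have key : ∀ x y : Fin 4 → ZMod 2, y ⬝ᵥ x = 0 → x = 0 ∨ ∃ k, y = altMatrix (kerdock k) *ᵥ x := by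
    decide +kernel
  rcases key p.2 p.1 hp with h | ⟨k, h⟩
  · exact ⟨0, h⟩
  · exact ⟨k.succ, mem_stdSpread_succ.2 h⟩

theorem finrank_stdSpread (i : Fin 9) : Module.finrank (ZMod 2) (stdSpread i) = 4 := by
  suffices ∃ f : (Fin 4 → ZMod 2) →ₗ[ZMod 2] Model, Function.Injective f ∧
      LinearMap.range f = stdSpread i by
    obtain ⟨f, hf, h⟩ := this
    rw [← h, LinearMap.finrank_range_of_inj hf]; simp
  induction i using Fin.cases with
  | zero =>
    refine ⟨LinearMap.inl _ _ _, LinearMap.inl_injective, ?_⟩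
    rw [LinearMap.range_inl]; rfl
  | succ k =>
    refine ⟨(altMatrix (kerdock k)).mulVecLin.prod LinearMap.id,
      fun x y h => congrArg Prod.snd h, ?_⟩
    ext p
    rw [mem_stdSpread_succ]
    exact ⟨by rintro ⟨x, rfl⟩; rfl, fun h => ⟨p.2, Prod.ext h.symm rfl⟩⟩

/-- The pullback of the standard spread under an isometry is a partition of the isotropic points. -/
theorem isPartition_of_isometry {Φ : Mod2 ≃ₗ[ZMod 2] Model} (hΦ : ∀ v, modelForm (Φ v) = Q v) :
    IsPartition fun i => (stdSpread i).comap (Φ : Mod2 →ₗ[ZMod 2] Model) where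
  isotropic i := by
    refine ⟨?_, fun v hv => ?_⟩
    · have h := Submodule.map_equiv_eq_comap_symm Φ.symm (stdSpread i)
      rw [LinearEquiv.symm_symm] at h
      rw [← h, LinearEquiv.finrank_map_eq, finrank_stdSpread]
    · rw [← hΦ]; exact modelForm_eq_zero_of_mem hv
  disjoint i j hij := by
    rw [Submodule.disjoint_def]
    intro v hi hj
    exact Φ.map_eq_zero_iff.1 (Submodule.disjoint_def.1 (disjoint_stdSpread hij) _ hi hj)
  cover v hv := exists_mem_stdSpread ((hΦ v).trans hv.2)

theorem exists_isPartition_of_disjoint {W₁ W₂ : Submodule (ZMod 2) Mod2}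
    (h₁ : IsIsotropic4Space W₁) (h₂ : IsIsotropic4Space W₂) (hd : Disjoint W₁ W₂) :
    ∃ V, IsPartition V ∧ V 0 = W₁ ∧ V 1 = W₂ := by
  obtain ⟨Φ, hΦ, hW₁, hW₂⟩ := exists_isometry_of_disjoint h₁ h₂ hd
  refine ⟨_, isPartition_of_isometry hΦ, ?_, ?_⟩
  · ext v; exact (hW₁ v).symm
  · have h0 : altMatrix (kerdock 0) = 0 := by decide
    ext v
    rw [hW₂]
    change Φ v ∈ stdSpread (0 : Fin 8).succ ↔ _
    rw [mem_stdSpread_succ, h0, zero_mulVec]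

/-! ### Uniqueness of the spread -/

/-- Eight alternating matrices with nonsingular pairwise differences are a translate of the standard
family. -/
theorem exists_translate {B : Fin 8 → Fin 6 → ZMod 2}
    (hB : ∀ i j, i ≠ j → pfaffian (B i + B j) = 1) :
    ∃ t, ∀ i, ∃ j, B i + t = kerdock j := by
  have hself : ∀ a : Fin 6 → ZMod 2, a + a = 0 := fun a => by
    ext i; exact CharTwo.add_self_eq_zero _
  -- the family translated so that it contains `0`
  set b : Fin 8 → Fin 6 → ZMod 2 := fun i => B i + B 0 with hb
  have hbb : ∀ i j, b i + b j = B i + B j := fun i j => by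
    rw [hb]; simp only
    rw [add_add_add_comm, hself, add_zero]
  have h1 : ∀ i j, i ≠ j → pfaffian (b i + b j) = 1 := fun i j h => by rw [hbb]; exact hB i j h
  have h0 : ∀ i, i ≠ 0 → pfaffian (b i) = 1 := fun i h => hB i 0 h
  obtain ⟨c, hc1, hc2, hc⟩ := exists_near (b 1) (h0 1 (by decide)) (b 2) (h0 2 (by decide))
    (h1 1 2 (by decide))
  refine ⟨B 0 + kerdock c, fun i => ?_⟩
  suffices Near c (b i) by
    obtain ⟨j, hj⟩ := this
    exact ⟨j, by rw [← hj, hb, add_assoc]⟩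
  rcases eq_or_ne i 0 with rfl | hi0
  · exact ⟨c, by rw [hb]; simp only; rw [hself, zero_add]⟩
  rcases eq_or_ne i 1 with rfl | hi1
  · exact hc1
  rcases eq_or_ne i 2 with rfl | hi2
  · exact hc2
  refine hc (b i) (h0 i hi0) (h1 1 i hi1.symm) (h1 2 i hi2.symm) fun h => ?_
  -- a fourth member shows that no three members sum to zero
  obtain ⟨l, hl0, hl1, hl2, hli⟩ : ∃ l : Fin 8, l ≠ 0 ∧ l ≠ 1 ∧ l ≠ 2 ∧ l ≠ i := by
    exact (by decide : ∀ i : Fin 8, ∃ l : Fin 8, l ≠ 0 ∧ l ≠ 1 ∧ l ≠ 2 ∧ l ≠ i) i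
  have key : ∀ x a b : Fin 6 → ZMod 2, pfaffian (x + (a + b)) =
      pfaffian (x + a) + pfaffian (x + b) + pfaffian (a + b) - pfaffian x - pfaffian a
        - pfaffian b := by
    intro x a b
    simp only [pfaffian, Pi.add_apply]; ring
  have := key (b l) (b 1) (b 2)
  rw [← h, h1 l i hli, h1 l 1 hl1, h1 l 2 hl2, h0 i hi0, h0 l hl0, h0 1 (by decide),
    h0 2 (by decide)] at this
  exact absurd this (by decide)

theorem exists_altMatrix_eq {A : Matrix (Fin 4) (Fin 4) (ZMod 2)} (h : ∀ x, A *ᵥ x ⬝ᵥ x = 0) :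
    ∃ a, altMatrix a = A := by
  have hd : ∀ i, A i i = 0 := fun i => by simpa using h (Pi.single i 1)
  have hs : ∀ i j, A i j = A j i := fun i j => by
    have := h (Pi.single i 1 + Pi.single j 1)
    rw [mulVec_add, dotProduct_add, add_dotProduct, add_dotProduct] at this
    simp [hd] at this
    exact CharTwo.add_eq_zero.1 this
  refine ⟨![A 0 1, A 0 2, A 0 3, A 1 2, A 1 3, A 2 3], ?_⟩
  ext i j
  fin_cases i <;> fin_cases j <;> simp [altMatrix, hd] <;> exact hs _ _

/-- An isotropic 4-space that is disjoint from the first summand of the model is the graph of an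
alternating matrix. -/
theorem exists_graph {W₁ W : Submodule (ZMod 2) Mod2} {Φ : Mod2 ≃ₗ[ZMod 2] Model}
    (hΦ : ∀ v, modelForm (Φ v) = Q v) (hW₁ : ∀ v, v ∈ W₁ ↔ (Φ v).2 = 0)
    (hW : IsIsotropic4Space W) (hd : Disjoint W₁ W) :
    ∃ a, ∀ v, v ∈ W ↔ (Φ v).1 = altMatrix a *ᵥ (Φ v).2 := by
  let L : W →ₗ[ZMod 2] (Fin 4 → ZMod 2) :=
    (LinearMap.snd _ _ _).comp ((Φ : Mod2 →ₗ[ZMod 2] Model).comp W.subtype)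
  have hinj : Function.Injective L := by
    rw [← LinearMap.ker_eq_bot, LinearMap.ker_eq_bot']
    intro w hw
    exact Subtype.ext (Submodule.disjoint_def.1 hd _ ((hW₁ _).2 hw) w.2)
  let E : W ≃ₗ[ZMod 2] (Fin 4 → ZMod 2) :=
    LinearEquiv.ofInjectiveOfFinrankEq L hinj (by rw [hW.1]; simp)
  have hE : ∀ w, E w = (Φ (w : Mod2)).2 := fun _ => rfl
  let A : Matrix (Fin 4) (Fin 4) (ZMod 2) := LinearMap.toMatrix' ((LinearMap.fst _ _ _).comp
    ((Φ : Mod2 →ₗ[ZMod 2] Model).comp (W.subtype.comp (E.symm : (Fin 4 → ZMod 2) →ₗ[ZMod 2] W))))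
  have hA : ∀ x, A *ᵥ x = (Φ (E.symm x : Mod2)).1 := fun x => LinearMap.toMatrix'_mulVec _ _
  have hE' : ∀ x, (Φ (E.symm x : Mod2)).2 = x := fun x => by rw [← hE, E.apply_symm_apply]
  obtain ⟨a, ha⟩ := exists_altMatrix_eq (A := A) fun x => by
    have := hΦ (E.symm x : Mod2)
    rwa [hW.2 _ (E.symm x).2, modelForm, hE', ← hA] at this
  refine ⟨a, fun v => ?_⟩
  rw [ha, hA]
  constructor
  · intro hv
    rw [show (Φ v).2 = E ⟨v, hv⟩ from rfl, E.symm_apply_apply]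
  · intro hv
    have : v = (E.symm (Φ v).2 : Mod2) := Φ.injective (Prod.ext hv (hE' _).symm)
    rw [this]; exact (E.symm _).2

/-- Every spread is the image of the standard one under an isometry. -/
theorem IsPartition.exists_isometry {V : Fin 9 → Submodule (ZMod 2) Mod2} (hV : IsPartition V) :
    ∃ Φ : Mod2 ≃ₗ[ZMod 2] Model, (∀ v, modelForm (Φ v) = Q v) ∧
      ∃ τ : Equiv.Perm (Fin 9), ∀ i v, v ∈ V i ↔ Φ v ∈ stdSpread (τ i) := by
  obtain ⟨Φ, hΦ, hV0, -⟩ := exists_isometry_of_disjoint (hV.isotropic 0) (hV.isotropic 1)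
    (hV.disjoint 0 1 (by decide))
  have hg : ∀ k : Fin 8, ∃ a, ∀ v, v ∈ V k.succ ↔ (Φ v).1 = altMatrix a *ᵥ (Φ v).2 := fun k =>
    exists_graph hΦ hV0 (hV.isotropic _) (hV.disjoint _ _ (Fin.succ_ne_zero k).symm)
  choose B hB using hg
  have hBB : ∀ i j, i ≠ j → pfaffian (B i + B j) = 1 := fun i j hij => by
    refine pfaffian_eq_one fun x hx h => hx ?_
    rw [altMatrix_add, add_mulVec] at h
    have h' : altMatrix (B i) *ᵥ x = altMatrix (B j) *ᵥ x := by
      ext k; exact CharTwo.add_eq_zero.1 (congrFun h k)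
    have hz := Submodule.disjoint_def.1 (hV.disjoint i.succ j.succ (by simpa using hij))
      (Φ.symm (altMatrix (B i) *ᵥ x, x)) ((hB i _).2 (by simp)) ((hB j _).2 (by simp [h']))
    rw [LinearEquiv.map_eq_zero_iff] at hz
    exact congrArg Prod.snd hz
  obtain ⟨t, ht⟩ := exists_translate hBB
  choose τ hτ using ht
  have hτinj : Function.Injective τ := fun i j hij => by
    by_contra hne
    have h1 : B i + t = B j + t := by rw [hτ, hτ, hij]
    have h2 := hBB i j hne
    rw [add_right_cancel h1,
      show B j + B j = 0 from funext fun _ => CharTwo.add_self_eq_zero _] at h2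
    exact absurd h2 (by decide)
  -- the shear by `altMatrix t` moves the graphs of the `B k` to members of the standard spread
  let shear : Model →ₗ[ZMod 2] Model :=
    (LinearMap.fst _ _ _ + (altMatrix t).mulVecLin.comp (LinearMap.snd _ _ _)).prod
      (LinearMap.snd _ _ _)
  have hshear : ∀ p, shear p = (p.1 + altMatrix t *ᵥ p.2, p.2) := fun _ => rfl
  have hsinj : Function.Injective shear := fun p q h => by
    rw [hshear, hshear, Prod.mk.injEq] at h
    refine Prod.ext ?_ h.2
    have := h.1
    rw [h.2] at this
    exact add_right_cancel this
  let S : Model ≃ₗ[ZMod 2] Model := LinearEquiv.ofInjectiveEndo shear hsinj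
  have hS : ∀ p, S p = (p.1 + altMatrix t *ᵥ p.2, p.2) := fun _ => rfl
  let τ' : Fin 9 → Fin 9 := Fin.cases 0 fun k => (τ k).succ
  have hτ' : Function.Injective τ' := by
    intro i j
    induction i using Fin.cases with
    | zero =>
      induction j using Fin.cases with
      | zero => exact fun _ => rfl
      | succ l => exact fun h => absurd h (Fin.succ_ne_zero (τ l)).symm
    | succ k =>
      induction j using Fin.cases with
      | zero => exact fun h => absurd h (Fin.succ_ne_zero (τ k))
      | succ l => exact fun h => congrArg _ (hτinj (Fin.succ_injective _ h))
  refine ⟨Φ.trans S, fun v => ?_, Equiv.ofBijective τ' (Finite.injective_iff_bijective.1 hτ'),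
    fun i v => ?_⟩
  · rw [LinearEquiv.trans_apply, hS, modelForm]
    simp only [add_dotProduct, altMatrix_dotProduct, add_zero]
    exact hΦ v
  · rw [LinearEquiv.trans_apply, Equiv.ofBijective_apply]
    induction i using Fin.cases with
    | zero => exact hV0 v
    | succ k =>
      change _ ↔ _ ∈ stdSpread (τ k).succ
      rw [mem_stdSpread_succ, hS, ← hτ, altMatrix_add, add_mulVec, hB, add_left_inj]

/-! ### Generators of the alternating group of degree 9 -/

/-- The 3-cycles through two fixed points generate the alternating group. -/
theorem alternatingGroup_le_of_swap_mul_swap {α : Type*} [Fintype α] [DecidableEq α] {a b : α}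
    (hab : a ≠ b) {H : Subgroup (Equiv.Perm α)}
    (h : ∀ k, k ≠ a → k ≠ b → Equiv.swap a b * Equiv.swap b k ∈ H) : alternatingGroup α ≤ H := by
  have h1 : ∀ k, k ≠ b → Equiv.swap a b * Equiv.swap b k ∈ H := fun k hk => by
    rcases eq_or_ne k a with rfl | hka
    · rw [Equiv.swap_comm b k, Equiv.swap_mul_self]; exact H.one_mem
    · exact h k hka hk
  have h2 : ∀ k l, k ≠ b → l ≠ b → Equiv.swap b k * Equiv.swap b l ∈ H := fun k l hk hl => by
    have := H.mul_mem (H.inv_mem (h1 k hk)) (h1 l hl)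
    rwa [_root_.mul_inv_rev, Equiv.swap_inv, Equiv.swap_inv, mul_assoc,
      ← mul_assoc (Equiv.swap a b),
      Equiv.swap_mul_self, one_mul] at this
  -- a transposition is an odd product of transpositions through `b`
  have h3 : ∀ x y z, x ≠ y → y ≠ z → x ≠ z → Equiv.swap x y * Equiv.swap y z ∈ H := by
    intro x y z hxy hyz hxz
    rcases eq_or_ne y b with rfl | hy
    · rw [Equiv.swap_comm x]; exact h2 _ _ hxy hyz.symm
    have e : ∀ w, w ≠ b → y ≠ w →
        Equiv.swap y w = Equiv.swap b y * Equiv.swap b w * Equiv.swap b y := by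
      intro w hw hyw
      have := Equiv.swap_mul_swap_mul_swap (x := w) (y := b) (z := y) hw hyw.symm
      rw [Equiv.swap_comm w b] at this
      exact this.symm
    rcases eq_or_ne x b with rfl | hx
    · rw [e z hxz.symm hyz, mul_assoc, ← mul_assoc, Equiv.swap_mul_self, one_mul]
      exact h2 _ _ hxz.symm hy
    rcases eq_or_ne z b with rfl | hz
    · rw [Equiv.swap_comm x, e x hx hxy.symm, Equiv.swap_comm y z, mul_assoc, Equiv.swap_mul_self,
        mul_one]
      exact h2 _ _ hy hx
    · rw [Equiv.swap_comm x, e x hx hxy.symm, e z hz hyz]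
      have := H.mul_mem (h2 y x hy hx) (h2 z y hz hy)
      simpa [mul_assoc] using this
  rw [← Equiv.Perm.closure_three_cycles_eq_alternating, Subgroup.closure_le]
  intro σ hσ
  obtain ⟨x, hx⟩ : σ.support.Nonempty := Finset.card_pos.1 (by rw [hσ.card_support]; norm_num)
  have hn := hσ.nodup_iff_mem_support.2 hx
  rw [hσ.eq_swap_mul_swap_iff_mem_support.2 hx]
  simp only [List.nodup_cons, List.mem_cons, List.not_mem_nil, or_false, not_or] at hn
  exact h3 _ _ _ hn.1.1 hn.2.1 hn.1.2

theorem alternatingGroup_le_of_finRotate_mem {H : Subgroup (Equiv.Perm (Fin 9))}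
    (hr : finRotate 9 ∈ H) (ht : Equiv.swap 2 3 * Equiv.swap 3 4 ∈ H) :
    alternatingGroup (Fin 9) ≤ H := by
  set r := finRotate 9
  set t : Equiv.Perm (Fin 9) := Equiv.swap 2 3 * Equiv.swap 3 4
  have hconj : ∀ {x y}, x ∈ H → y ∈ H → x * y * x⁻¹ ∈ H := fun hx hy =>
    H.mul_mem (H.mul_mem hx hy) (H.inv_mem hx)
  -- the 3-cycles of consecutive points
  have u1 := hconj hr ht
  have u2 := hconj hr u1
  have u3 := hconj hr u2
  have u4 := hconj hr u3
  have v1 := hconj (H.inv_mem hr) ht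
  have v2 := hconj (H.inv_mem hr) v1
  -- the 3-cycles through `7` and `8`
  have t5 := hconj (H.inv_mem u2) u4
  have t4 := hconj u2 u4
  have t3 := hconj u1 t5
  have t2 := hconj ht t4
  have t1 := hconj v1 t3
  have t0 := hconj v2 t2
  refine alternatingGroup_le_of_swap_mul_swap (a := 7) (b := 8) (by decide) fun k h7 h8 => ?_
  fin_cases k
  · convert t0 using 1; decide +kernel
  · convert t1 using 1; decide +kernel
  · convert t2 using 1; decide +kernel
  · convert t3 using 1; decide +kernel
  · convert t4 using 1; decide +kernel
  · convert t5 using 1; decide +kernel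
  · convert u4 using 1; decide +kernel
  · exact absurd rfl h7
  · exact absurd rfl h8

/-! ### The symmetries of the standard spread -/

theorem eq_of_mem_stdSpread {p : Model} (hp : p ≠ 0) {i j : Fin 9} (hi : p ∈ stdSpread i)
    (hj : p ∈ stdSpread j) : i = j := by
  by_contra h
  exact hp (Submodule.disjoint_def.1 (disjoint_stdSpread h) p hi hj)

theorem injective_of_modelForm {f : Model →ₗ[ZMod 2] Model}
    (hf : ∀ p, modelForm (f p) = modelForm p) : Function.Injective f := by
  rw [← LinearMap.ker_eq_bot, LinearMap.ker_eq_bot']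
  intro p hp
  refine modelForm_nondegenerate fun q => ?_
  rw [← hf (p + q), map_add, hp, zero_add, hf, ← hf p, hp]
  simp [modelForm]

/-- The permutations of the standard spread that are induced by isometries. -/
def spreadPerms : Subgroup (Equiv.Perm (Fin 9)) where
  carrier := {σ | ∃ g : Model ≃ₗ[ZMod 2] Model, (∀ p, modelForm (g p) = modelForm p) ∧
    ∀ i p, p ∈ stdSpread i ↔ g p ∈ stdSpread (σ i)}
  mul_mem' := by
    rintro σ τ ⟨g, hg, hg'⟩ ⟨h, hh, hh'⟩
    exact ⟨h.trans g, fun p => (hg _).trans (hh p), fun i p => (hh' i p).trans (hg' _ _)⟩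
  one_mem' := ⟨LinearEquiv.refl _ _, fun _ => rfl, fun _ _ => Iff.rfl⟩
  inv_mem' := by
    rintro σ ⟨g, hg, hg'⟩
    refine ⟨g.symm, fun p => ?_, fun i p => ?_⟩
    · rw [← hg, g.apply_symm_apply]
    · rw [hg' (σ⁻¹ i), g.apply_symm_apply, show σ (σ⁻¹ i) = i from σ.apply_symm_apply i]

/-- For an isometry that permutes the members of the standard spread, one inclusion suffices,
because every isotropic vector lies in some member. -/
theorem mem_spreadPerms {σ : Equiv.Perm (Fin 9)} (f : Model →ₗ[ZMod 2] Model)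
    (hf : ∀ p, modelForm (f p) = modelForm p)
    (hfσ : ∀ i p, p ∈ stdSpread i → f p ∈ stdSpread (σ i)) : σ ∈ spreadPerms := by
  have hinj := injective_of_modelForm hf
  refine ⟨LinearEquiv.ofInjectiveEndo f hinj, hf, fun i p => ⟨hfσ i p, fun h => ?_⟩⟩
  change f p ∈ _ at h
  rcases eq_or_ne p 0 with rfl | hp
  · exact zero_mem _
  obtain ⟨j, hj⟩ := exists_mem_stdSpread ((hf p).symm.trans (modelForm_eq_zero_of_mem h))
  have hfp : f p ≠ 0 := fun h0 => hp (hinj (h0.trans (map_zero f).symm))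
  rwa [σ.injective (eq_of_mem_stdSpread hfp h (hfσ j p hj))]

/-- An isometry that permutes the nine members of the standard spread cyclically. -/
def rotation : Model →ₗ[ZMod 2] Model where
  toFun p := (![p.2 0, p.2 1 + p.2 3, p.2 1, p.2 2],
    ![p.1 0 + p.2 2, p.1 3 + p.2 1, p.1 1 + p.1 3 + p.2 1 + p.2 2 + p.2 3, p.1 2 + p.2 0 + p.2 1])
  map_add' p q := by ext i <;> fin_cases i <;> simp <;> ring
  map_smul' c p := by ext i <;> fin_cases i <;> simp <;> ring

/-- An isometry that induces a 3-cycle on the standard spread. -/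
def threeCycle : Model →ₗ[ZMod 2] Model where
  toFun p := (![p.1 3, p.1 2, p.1 1 + p.1 2, p.1 0 + p.1 3],
    ![p.2 0 + p.2 3, p.2 1 + p.2 2, p.2 1, p.2 0])
  map_add' p q := by ext i <;> fin_cases i <;> simp <;> ring
  map_smul' c p := by ext i <;> fin_cases i <;> simp <;> ring

theorem finRotate_mem_spreadPerms : finRotate 9 ∈ spreadPerms := by
  refine mem_spreadPerms rotation ?_ ?_
  · unfold modelForm; decide +kernel
  · decide +kernel

theorem swap_mul_swap_mem_spreadPerms : Equiv.swap 2 3 * Equiv.swap 3 4 ∈ spreadPerms := by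
  refine mem_spreadPerms threeCycle ?_ ?_
  · unfold modelForm; decide +kernel
  · decide +kernel

theorem alternatingGroup_le_spreadPerms : alternatingGroup (Fin 9) ≤ spreadPerms :=
  alternatingGroup_le_of_finRotate_mem finRotate_mem_spreadPerms swap_mul_swap_mem_spreadPerms

/-- An injective linear map that preserves seven members of the standard spread is the identity: it
is given by its restrictions `R` and `P` to the two summands, and these intertwine five of the
matrices. -/
theorem eq_id_of_preserves {f : Model →ₗ[ZMod 2] Model} (hinj : Function.Injective f)
    (hf : ∀ i, i ≠ 2 → i ≠ 3 → ∀ p ∈ stdSpread i, f p ∈ stdSpread i) (p : Model) : f p = p := by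
  let R : Matrix (Fin 4) (Fin 4) (ZMod 2) :=
    LinearMap.toMatrix' ((LinearMap.fst _ _ _).comp (f.comp (LinearMap.inl _ _ _)))
  let P : Matrix (Fin 4) (Fin 4) (ZMod 2) :=
    LinearMap.toMatrix' ((LinearMap.snd _ _ _).comp (f.comp (LinearMap.inr _ _ _)))
  have hk0 : altMatrix (kerdock 0) = 0 := by decide
  have hR₀ : ∀ y, R *ᵥ y = (f (y, 0)).1 := fun y => LinearMap.toMatrix'_mulVec _ _
  have hP₀ : ∀ x, P *ᵥ x = (f (0, x)).2 := fun x => LinearMap.toMatrix'_mulVec _ _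
  have hR : ∀ y, f (y, 0) = (R *ᵥ y, 0) := fun y =>
    Prod.ext (hR₀ y).symm
      (mem_stdSpread_zero.1 (hf 0 (by decide) (by decide) (y, 0) rfl))
  have hP : ∀ x, f (0, x) = (0, P *ᵥ x) := fun x => by
    refine Prod.ext ?_ (hP₀ x).symm
    have h1 := hf (0 : Fin 8).succ (by decide) (by decide) (0, x)
      (mem_stdSpread_succ.2 (by rw [hk0, zero_mulVec]))
    rwa [mem_stdSpread_succ, hk0, zero_mulVec] at h1
  have hf' : ∀ y x, f (y, x) = (R *ᵥ y, P *ᵥ x) := fun y x => by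
    have : ((y, x) : Model) = (y, 0) + (0, x) := by simp
    rw [this, map_add, hR, hP]; simp
  obtain ⟨c, hRc, hPc⟩ := eq_smul_one_of_intertwines (R := R) (P := P) fun j hj => by
    refine Matrix.ext_of_mulVec_single fun k => ?_
    have h1 := hf j.succ (by revert hj; revert j; decide) (by revert hj; revert j; decide)
      (altMatrix (kerdock j) *ᵥ Pi.single k 1, Pi.single k 1) (mem_stdSpread_succ.2 rfl)
    rw [mem_stdSpread_succ, hf'] at h1
    simpa only [mulVec_mulVec] using h1
  have hc : ∀ p, f p = c • p := fun p => by
    rw [← Prod.mk.eta (p := p), hf', hRc, hPc, smul_mulVec, smul_mulVec, one_mulVec, one_mulVec]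
    rfl
  have hc1 : c = 1 := by
    have h01 : ∀ a : ZMod 2, a ≠ 0 → a = 1 := by decide
    refine h01 c fun h0 => ?_
    have := @hinj (Pi.single 0 1, 0) 0 (by rw [hc, hc, h0, zero_smul, zero_smul])
    exact absurd (congrFun (congrArg Prod.fst this) 0) (by simp)
  rw [hc, hc1, one_smul]

/-- Isometries induce only even permutations of the standard spread, because none of them induces
the transposition of two members: fixing the other seven already makes an isometry trivial. -/
theorem spreadPerms_le_alternatingGroup : spreadPerms ≤ alternatingGroup (Fin 9) := by
  intro σ hσ
  by_contra hodd
  -- otherwise the transposition of two members would be induced by an isometry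
  have h1 : Equiv.swap 2 3 * σ ∈ alternatingGroup (Fin 9) := by
    rw [Equiv.Perm.mem_alternatingGroup] at hodd ⊢
    rw [Equiv.Perm.sign_mul, Equiv.Perm.sign_swap (by decide),
      (Int.units_eq_one_or _).resolve_left hodd]
    rfl
  have h2 : Equiv.swap 2 3 ∈ spreadPerms := by
    have := spreadPerms.mul_mem (alternatingGroup_le_spreadPerms h1) (spreadPerms.inv_mem hσ)
    rwa [mul_inv_cancel_right] at this
  obtain ⟨g, -, hg⟩ := h2
  have h3 := eq_id_of_preserves (f := g) g.injective fun i h2 h3 p hp => by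
    have := (hg i p).1 hp
    rwa [Equiv.swap_apply_of_ne_of_ne h2 h3] at this
  have h4 : ∃ p : Model, p ≠ 0 ∧ p ∈ stdSpread 2 :=
    ⟨(altMatrix (kerdock 1) *ᵥ Pi.single 0 1, Pi.single 0 1), by
      intro h; exact absurd (congrFun (congrArg Prod.snd h) 0) (by simp),
      mem_stdSpread_succ (k := 1).2 rfl⟩
  obtain ⟨p, hp0, hp⟩ := h4
  have h5 := (hg 2 p).1 hp
  rw [Equiv.swap_apply_left] at h5
  have h6 : g p = p := h3 p
  rw [h6] at h5
  exact absurd (eq_of_mem_stdSpread hp0 hp h5) (by decide)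

/-! ### The stabilizer of a spread -/

theorem map_eq_iff {g : Mod2 ≃ₗ[ZMod 2] Mod2} {W W' : Submodule (ZMod 2) Mod2} :
    W.map (g : Mod2 →ₗ[ZMod 2] Mod2) = W' ↔ ∀ v, v ∈ W ↔ g v ∈ W' := by
  constructor
  · rintro rfl v
    exact ⟨fun h => ⟨v, h, rfl⟩, by rintro ⟨w, hw, h⟩; rwa [← g.injective h]⟩
  · intro h
    ext v
    obtain ⟨w, rfl⟩ := g.surjective v
    rw [← h]
    exact ⟨by rintro ⟨u, hu, h'⟩; rwa [← g.injective h'], fun hw => ⟨w, hw, rfl⟩⟩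

namespace IsPartition

variable {V : Fin 9 → Submodule (ZMod 2) Mod2}

theorem injective (hV : IsPartition V) : Function.Injective V := by
  intro i j hij
  by_contra h
  have h1 := hV.disjoint i j h
  rw [← hij, disjoint_self] at h1
  have h2 := (hV.isotropic i).1
  rw [h1, finrank_bot] at h2
  exact absurd h2 (by norm_num)

theorem ncard_ne_zero (hV : IsPartition V) (i : Fin 9) : {v | v ∈ V i ∧ v ≠ 0}.ncard = 15 := by
  have h : {v | v ∈ V i ∧ v ≠ 0} = (V i : Set Mod2) \ {0} := rfl
  rw [h, Set.ncard_sdiff_singleton_of_mem (zero_mem _), ← Nat.card_coe_set_eq]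
  have := Module.natCard_eq_pow_finrank (K := ZMod 2) (V := V i)
  rw [(hV.isotropic i).1, Nat.card_zmod] at this
  change Nat.card (V i) - 1 = 15
  rw [this]; rfl

/-- The permutations of a spread that are induced by isometries are exactly the even ones. -/
theorem exists_map_eq_iff (hV : IsPartition V) (σ : Equiv.Perm (Fin 9)) :
    (∃ g ∈ orthogonalGroup, ∀ i, (V i).map (g : Mod2 →ₗ[ZMod 2] Mod2) = V (σ i)) ↔
      σ ∈ alternatingGroup (Fin 9) := by
  obtain ⟨Φ, hΦ, τ, hτ⟩ := hV.exists_isometry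
  have hconj : τ * σ * τ⁻¹ ∈ alternatingGroup (Fin 9) ↔ σ ∈ alternatingGroup (Fin 9) := by
    rw [Equiv.Perm.mem_alternatingGroup, Equiv.Perm.mem_alternatingGroup]
    rw [map_mul, map_mul, map_inv, mul_inv_cancel_comm]
  constructor
  · rintro ⟨g, hg, h⟩
    rw [← hconj]
    refine spreadPerms_le_alternatingGroup ⟨Φ.symm.trans (g.trans Φ), fun p => ?_, fun i p => ?_⟩
    · change modelForm (Φ (g (Φ.symm p))) = _
      rw [hΦ, show Q (g (Φ.symm p)) = _ from hg _, ← hΦ, Φ.apply_symm_apply]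
    · change _ ↔ Φ (g (Φ.symm p)) ∈ stdSpread (τ (σ (τ⁻¹ i)))
      rw [← hτ, ← map_eq_iff.1 (h _), hτ, Φ.apply_symm_apply,
        show τ (τ⁻¹ i) = i from τ.apply_symm_apply i]
  · intro hσ
    obtain ⟨g, hg, h⟩ := alternatingGroup_le_spreadPerms (hconj.2 hσ)
    refine ⟨Φ.trans (g.trans Φ.symm), fun v => ?_, fun i => map_eq_iff.2 fun v => ?_⟩
    · change Q (Φ.symm (g (Φ v))) = _
      rw [← hΦ, Φ.apply_symm_apply, hg, hΦ]
    · change _ ↔ Φ.symm (g (Φ v)) ∈ _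
      rw [hτ, hτ, Φ.apply_symm_apply, h,
        show (τ * σ * τ⁻¹) (τ i) = τ (σ i) from congrArg (τ ∘ σ) (τ.symm_apply_apply i)]

theorem eq_one_of_map_eq (hV : IsPartition V) {g : Mod2 ≃ₗ[ZMod 2] Mod2}
    (h : ∀ i, (V i).map (g : Mod2 →ₗ[ZMod 2] Mod2) = V i) : g = 1 := by
  obtain ⟨Φ, hΦ, τ, hτ⟩ := hV.exists_isometry
  have key := eq_id_of_preserves (f := (Φ.symm.trans (g.trans Φ) : Model ≃ₗ[ZMod 2] Model))
    (Φ.symm.trans (g.trans Φ)).injective fun i _ _ p hp => by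
      change Φ (g (Φ.symm p)) ∈ _
      have e : τ (τ⁻¹ i) = i := τ.apply_symm_apply i
      rw [← e, ← hτ, ← map_eq_iff.1 (h _), hτ, Φ.apply_symm_apply, e]
      exact hp
  refine LinearEquiv.ext fun v => Φ.injective ?_
  have := key (Φ v)
  change Φ (g (Φ.symm (Φ v))) = _ at this
  rwa [Φ.symm_apply_apply] at this

/-- The action of the isometries that preserve a spread on its nine members is an isomorphism with
the alternating group. -/
theorem exists_mulEquiv (hV : IsPartition V) :
    ∃ e : (orthogonalGroup ⊓ permuters V : Subgroup _) ≃* alternatingGroup (Fin 9),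
      ∀ (g : (orthogonalGroup ⊓ permuters V : Subgroup _)) i,
        (V i).map ((g : Mod2 ≃ₗ[ZMod 2] Mod2) : Mod2 →ₗ[ZMod 2] Mod2) =
        V ((e g : Equiv.Perm (Fin 9)) i) := by
  have hσ : ∀ g : (orthogonalGroup ⊓ permuters V : Subgroup _),
      ∃ σ : alternatingGroup (Fin 9), ∀ i,
        (V i).map ((g : Mod2 ≃ₗ[ZMod 2] Mod2) : Mod2 →ₗ[ZMod 2] Mod2) =
          V ((σ : Equiv.Perm (Fin 9)) i) := by
    rintro ⟨g, hg, σ, h⟩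
    exact ⟨⟨σ, (hV.exists_map_eq_iff σ).1 ⟨g, hg, h⟩⟩, h⟩
  choose π hπ using hσ
  have huniq : ∀ {g σ}, (∀ i, (V i).map ((g : Mod2 ≃ₗ[ZMod 2] Mod2) : Mod2 →ₗ[ZMod 2] Mod2) =
      V ((σ : Equiv.Perm (Fin 9)) i)) → ∀ {σ'}, (∀ i,
      (V i).map (g : Mod2 →ₗ[ZMod 2] Mod2) = V ((σ' : Equiv.Perm (Fin 9)) i)) → σ = σ' :=
    fun h _ h' => Equiv.ext fun i => hV.injective ((h i).symm.trans (h' i))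
  let f : (orthogonalGroup ⊓ permuters V : Subgroup _) →* alternatingGroup (Fin 9) :=
    MonoidHom.mk' π fun g h => Subtype.ext (huniq (hπ (g * h)) fun i => by
      change _ = V ((π g : Equiv.Perm (Fin 9)) ((π h : Equiv.Perm (Fin 9)) i))
      rw [← hπ g, ← hπ h]
      exact Submodule.map_comp _ _ _)
  refine ⟨MulEquiv.ofBijective f ⟨(injective_iff_map_eq_one f).2 fun g hg => ?_, fun σ => ?_⟩, hπ⟩
  · refine Subtype.ext (hV.eq_one_of_map_eq fun i => ?_)
    rw [hπ, show π g = 1 from hg]; rfl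
  · obtain ⟨g, hg, h⟩ := (hV.exists_map_eq_iff σ).2 σ.2
    exact ⟨⟨g, hg, σ, h⟩, Subtype.ext (huniq (hπ _) h)⟩

end IsPartition

/-- A perfect group of isometries lies in the commutator subgroup `O₈⁺(2)`. -/
theorem range_le_O8plus {G : Type*} [Group G] (f : G →* Mod2 ≃ₗ[ZMod 2] Mod2)
    (hf : f.range ≤ orthogonalGroup) (hG : commutator G = ⊤) : f.range ≤ O8plus := by
  rw [MonoidHom.range_eq_map, ← hG, commutator_def, Subgroup.map_commutator,
    ← MonoidHom.range_eq_map]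
  exact Subgroup.commutator_mono hf hf

/-- The stabilizer of a spread is generated by three stabilizers of pairs of members. -/
theorem IsPartition.exists_subgroups {V : Fin 9 → Submodule (ZMod 2) Mod2} (hV : IsPartition V) :
    ∃ K H₀₁ H₀₂ H₁₂ : Subgroup (Mod2 ≃ₗ[ZMod 2] Mod2),
        ActsAsAlternating K V {0, 1, 2}ᶜ ∧
        ActsAsAlternating H₀₁ V {0, 1}ᶜ ∧
        ActsAsAlternating H₀₂ V {0, 2}ᶜ ∧
        ActsAsAlternating H₁₂ V {1, 2}ᶜ ∧
        K ≤ H₀₁ ∧ K ≤ H₀₂ ∧ K ≤ H₁₂ ∧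
        H₀₁ ≤ O8plus ∧ H₀₂ ≤ O8plus ∧ H₁₂ ≤ O8plus ∧
        ActsAsAlternating (H₀₁ ⊔ H₀₂ ⊔ H₁₂) V Finset.univ ∧
        H₀₁ ⊔ H₀₂ ⊔ H₁₂ = orthogonalGroup ⊓ permuters V := by
  obtain ⟨e, he⟩ := hV.exists_mulEquiv
  let E : alternatingGroup (Fin 9) →* Mod2 ≃ₗ[ZMod 2] Mod2 :=
    (Subgroup.subtype _).comp e.symm.toMonoidHom
  have hE : ∀ σ i, (V i).map (E σ : Mod2 →ₗ[ZMod 2] Mod2) = V ((σ : Equiv.Perm (Fin 9)) i) :=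
    fun σ i => by
      have := he (e.symm σ) i
      rwa [e.apply_symm_apply] at this
  have hEinj : Function.Injective E := Subtype.val_injective.comp e.symm.injective
  have hEr : E.range = orthogonalGroup ⊓ permuters V := by
    ext g
    exact ⟨by rintro ⟨σ, rfl⟩; exact (e.symm σ).2,
      fun hg => ⟨e ⟨g, hg⟩, congrArg Subtype.val (e.symm_apply_apply ⟨g, hg⟩)⟩⟩
  -- `H s` is the group that acts on the members with label in `s` and fixes the others
  let H (s : Finset (Fin 9)) : Subgroup (Mod2 ≃ₗ[ZMod 2] Mod2) :=
    (E.comp (alternatingGroup.ofSubtype s)).range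
  have hHmap : ∀ s, H s = (alternatingGroup.ofSubtype s).range.map E := fun s =>
    MonoidHom.range_comp _ _
  have hH : ∀ s, ActsAsAlternating (H s) V s := by
    intro s
    have hinj : Function.Injective (E.comp (alternatingGroup.ofSubtype s)) :=
      hEinj.comp alternatingGroup.ofSubtype_injective
    refine ⟨?_, (MonoidHom.ofInjective hinj).symm, ?_⟩
    · rintro _ ⟨σ, rfl⟩ i hi
      refine (hE _ i).trans ?_
      rw [alternatingGroup.coe_ofSubtype, Equiv.Perm.ofSubtype_apply_of_not_mem _ hi]
    · intro g i
      obtain ⟨σ, rfl⟩ := (MonoidHom.ofInjective hinj).surjective g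
      rw [MulEquiv.symm_apply_apply]
      refine (hE _ i).trans ?_
      rw [alternatingGroup.coe_ofSubtype, Equiv.Perm.ofSubtype_apply_coe]
  have hmem : ∀ s (σ : alternatingGroup (Fin 9)), (σ : Equiv.Perm (Fin 9)).support ⊆ s →
      E σ ∈ H s := fun s σ h => by
    rw [hHmap]
    exact Subgroup.mem_map_of_mem _ ((alternatingGroup.mem_range_ofSubtype_iff s σ).2 h)
  have hmono : ∀ s t, s ⊆ t → H s ≤ H t := by
    intro s t hst
    rw [hHmap, hHmap]
    refine Subgroup.map_mono fun σ hσ => ?_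
    rw [alternatingGroup.mem_range_ofSubtype_iff] at hσ ⊢
    exact hσ.trans hst
  have hle : ∀ s, H s ≤ orthogonalGroup ⊓ permuters V := fun s => by
    rw [hHmap, ← hEr, E.range_eq_map]
    exact Subgroup.map_mono le_top
  have hO : ∀ s : Finset (Fin 9), 5 ≤ s.card → H s ≤ O8plus := fun s hs =>
    range_le_O8plus _ ((hle s).trans inf_le_left)
      (commutator_alternatingGroup_eq_top (by simpa using hs))
  have htop : H {0, 1}ᶜ ⊔ H {0, 2}ᶜ ⊔ H {1, 2}ᶜ = orthogonalGroup ⊓ permuters V := by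
    refine le_antisymm (sup_le (sup_le (hle _) (hle _)) (hle _)) ?_
    rw [← hEr]
    set J := H {0, 1}ᶜ ⊔ H {0, 2}ᶜ ⊔ H {1, 2}ᶜ with hJ
    have h1 : ∀ s ∈ ({{0, 1}ᶜ, {0, 2}ᶜ, {1, 2}ᶜ} : Finset (Finset (Fin 9))), H s ≤ J := by
      intro s hs
      simp only [Finset.mem_insert, Finset.mem_singleton] at hs
      rcases hs with rfl | rfl | rfl
      exacts [le_sup_left.trans le_sup_left, le_sup_right.trans le_sup_left, le_sup_right]
    have h2 : alternatingGroup (Fin 9) ≤ (J.comap E).map (Subgroup.subtype _) := by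
      refine alternatingGroup_le_of_swap_mul_swap (a := 7) (b := 8) (by decide) fun k h7 h8 => ?_
      -- each of these 3-cycles fixes two of the labels `0`, `1`, `2`
      obtain ⟨s, hs, hk⟩ : ∃ s ∈ ({{0, 1}ᶜ, {0, 2}ᶜ, {1, 2}ᶜ} : Finset (Finset (Fin 9))),
          (Equiv.swap 7 8 * Equiv.swap 8 k).support ⊆ s := by
        revert h7 h8; revert k; decide +kernel
      have hA : Equiv.swap 7 8 * Equiv.swap 8 k ∈ alternatingGroup (Fin 9) := by
        rw [Equiv.Perm.mem_alternatingGroup, Equiv.Perm.sign_mul, Equiv.Perm.sign_swap (by decide),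
          Equiv.Perm.sign_swap h8.symm]
        rfl
      exact ⟨⟨_, hA⟩, h1 s hs (hmem s _ hk), rfl⟩
    rintro _ ⟨σ, rfl⟩
    obtain ⟨σ', hσ', h⟩ := h2 σ.2
    rw [← Subtype.ext h]
    exact hσ'
  have huniv : H Finset.univ = orthogonalGroup ⊓ permuters V := by
    refine le_antisymm (hle _) ?_
    rw [← htop]
    exact sup_le (sup_le (hmono _ _ (Finset.subset_univ _)) (hmono _ _ (Finset.subset_univ _)))
      (hmono _ _ (Finset.subset_univ _))
  refine ⟨H {0, 1, 2}ᶜ, H {0, 1}ᶜ, H {0, 2}ᶜ, H {1, 2}ᶜ, hH _, hH _, hH _, hH _,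
    hmono _ _ (by decide), hmono _ _ (by decide), hmono _ _ (by decide),
    hO _ (by decide), hO _ (by decide), hO _ (by decide), ?_, htop⟩
  rw [htop, ← huniv]
  exact hH _

/-! ### The double cover -/

/-- An automorphism `j` of the lattice with `j² = -1`. -/
def quarterTurn : Lattice →ₗ[ℤ] Lattice where
  toFun x := ![x 4 - 2 * x 6, x 3 - 2 * x 6 - x 7, x 3 + x 5 - 4 * x 6, 2 * x 3 - 5 * x 6,
    -x 0 + 2 * x 3 - 4 * x 6, -x 2 + 2 * x 3 - 3 * x 6, x 3 - 2 * x 6, x 1 - x 6]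
  map_add' x y := by ext i; fin_cases i <;> simp <;> ring
  map_smul' c x := by ext i; fin_cases i <;> simp <;> ring

theorem quarterTurn_quarterTurn (x : Lattice) : quarterTurn (quarterTurn x) = -x := by
  ext i; fin_cases i <;> simp [quarterTurn] <;> ring

theorem inner_quarterTurn (x y : Lattice) : inner (quarterTurn x) (quarterTurn y) = inner x y := by
  rw [inner_eq, inner_eq]
  simp [quarterTurn]
  ring

/-- The map that `quarterTurn` induces on the hyperbolic model. -/
def modelSwap : Model →ₗ[ZMod 2] Model where
  toFun p := (![p.1 1, p.1 0, p.1 3, p.1 2], ![p.2 1, p.2 0, p.2 3, p.2 2])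
  map_add' p q := by ext i <;> fin_cases i <;> simp
  map_smul' c p := by ext i <;> fin_cases i <;> simp

theorem coordFun_quarterTurn (x : Lattice) :
    coordFun (quarterTurn x) = modelSwap (coordFun x) := by
  have h2 : (2 : ZMod 2) = 0 := rfl
  have h3 : (3 : ZMod 2) = 1 := rfl
  have h4 : (4 : ZMod 2) = 0 := rfl
  have h5 : (5 : ZMod 2) = 1 := rfl
  ext i <;> fin_cases i <;> simp [coordFun, quarterTurn, modelSwap, h2, h3, h4, h5,
    CharTwo.sub_eq_add, CharTwo.neg_eq] <;> ring_nf <;> simp [h2, h3]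

theorem modelSwap_mem_stdSpread : ∀ i p, p ∈ stdSpread i →
    modelSwap p ∈ stdSpread ((Equiv.swap 5 7 * Equiv.swap 6 8 : Equiv.Perm (Fin 9)) i) := by
  decide +kernel

theorem exists_mem_Aut_sq_eq_neg : ∃ j ∈ Aut, j * j = LinearEquiv.neg ℤ ∧
    ∀ v i, coordEquiv v ∈ stdSpread i →
      coordEquiv (reduction j v) ∈
        stdSpread ((Equiv.swap 5 7 * Equiv.swap 6 8 : Equiv.Perm (Fin 9)) i) := by
  refine ⟨LinearEquiv.ofLinearMap quarterTurn (-quarterTurn) ?_ ?_, inner_quarterTurn, ?_, ?_⟩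
  · exact LinearMap.ext fun x => by
      change quarterTurn (-quarterTurn x) = x
      rw [map_neg, quarterTurn_quarterTurn, neg_neg]
  · exact LinearMap.ext fun x => by
      change -quarterTurn (quarterTurn x) = x
      rw [quarterTurn_quarterTurn, neg_neg]
  · exact LinearEquiv.ext quarterTurn_quarterTurn
  · intro v i hv
    obtain ⟨x, rfl⟩ := Submodule.Quotient.mk_surjective two v
    change coordFun (quarterTurn x) ∈ _
    rw [coordFun_quarterTurn]
    exact modelSwap_mem_stdSpread i _ hv

/-- Every spread is preserved by a lattice automorphism of square `-1` that acts on it as an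
involution. -/
theorem IsPartition.exists_sq_eq_neg {V : Fin 9 → Submodule (ZMod 2) Mod2} (hV : IsPartition V) :
    ∃ j ∈ Aut, j * j = LinearEquiv.neg ℤ ∧ ∃ σ : Equiv.Perm (Fin 9), σ * σ = 1 ∧
      ∀ i, (V i).map (reduction j : Mod2 →ₗ[ZMod 2] Mod2) = V (σ i) := by
  obtain ⟨Φ, hΦ, τ, hτ⟩ := hV.exists_isometry
  obtain ⟨j, hj, hj2, hjS⟩ := exists_mem_Aut_sq_eq_neg
  obtain ⟨h, hh, hred⟩ := exists_reduction_eq (g := coordEquiv.trans Φ.symm) fun v => by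
    rw [← hΦ, ← modelForm_coordEquiv]
    exact congrArg modelForm (Φ.apply_symm_apply _)
  set ρ : Equiv.Perm (Fin 9) := Equiv.swap 5 7 * Equiv.swap 6 8
  have hρ : ρ * ρ = 1 := by decide
  refine ⟨h * j * h⁻¹, Aut.mul_mem (Aut.mul_mem hh hj) (Aut.inv_mem hh), ?_, τ⁻¹ * ρ * τ, ?_,
    fun i => ?_⟩
  · calc h * j * h⁻¹ * (h * j * h⁻¹) = h * (j * j) * h⁻¹ := by group
      _ = LinearEquiv.neg ℤ := by
        rw [hj2]
        refine LinearEquiv.ext fun x => ?_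
        change h (-(h.symm x)) = -x
        rw [map_neg, h.apply_symm_apply]
  · calc τ⁻¹ * ρ * τ * (τ⁻¹ * ρ * τ) = τ⁻¹ * (ρ * ρ) * τ := by group
      _ = 1 := by rw [hρ]; group
  · refine Submodule.eq_of_le_of_finrank_eq ?_ ?_
    · rintro _ ⟨v, hv, rfl⟩
      obtain ⟨w, rfl⟩ := (coordEquiv.trans Φ.symm).surjective v
      have e1 : reduction (h * j * h⁻¹) ((coordEquiv.trans Φ.symm) w) =
          (coordEquiv.trans Φ.symm) (reduction j w) := by
        rw [map_mul, map_mul, map_inv, hred]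
        change (coordEquiv.trans Φ.symm) (reduction j
          ((coordEquiv.trans Φ.symm).symm ((coordEquiv.trans Φ.symm) w))) = _
        rw [LinearEquiv.symm_apply_apply]
      change reduction (h * j * h⁻¹) ((coordEquiv.trans Φ.symm) w) ∈ _
      have e2 : ∀ u, Φ ((coordEquiv.trans Φ.symm) u) = coordEquiv u := fun u =>
        Φ.apply_symm_apply _
      rw [SetLike.mem_coe, hτ, e2] at hv
      rw [e1, hτ, e2]
      have e3 : τ ((τ⁻¹ * ρ * τ) i) = ρ (τ i) := τ.apply_symm_apply _
      rw [e3]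
      exact hjS w _ hv
    · rw [LinearEquiv.finrank_map_eq, (hV.isotropic _).1, (hV.isotropic _).1]

/-- The stabilizer of a spread in `Aut(E₈)` is a nonsplit double cover of the alternating group. -/
theorem IsPartition.exists_doubleCover {V : Fin 9 → Submodule (ZMod 2) Mod2} (hV : IsPartition V) :
    ∃ φ : latticeStabilizer V →* alternatingGroup (Fin 9),
      Function.Surjective φ ∧
      (∀ (g : latticeStabilizer V) (i : Fin 9),
        (V i).map (reduction g : Mod2 →ₗ[ZMod 2] Mod2) = V ((φ g : Equiv.Perm (Fin 9)) i)) ∧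
      (∀ g : latticeStabilizer V, φ g = 1 ↔
        ((g : Lattice ≃ₗ[ℤ] Lattice) = 1 ∨ (g : Lattice ≃ₗ[ℤ] Lattice) = LinearEquiv.neg ℤ)) ∧
      ¬ ∃ ψ : alternatingGroup (Fin 9) →* latticeStabilizer V, φ.comp ψ = MonoidHom.id _ := by
  obtain ⟨e, he⟩ := hV.exists_mulEquiv
  let r : latticeStabilizer V →* (orthogonalGroup ⊓ permuters V : Subgroup _) :=
    (reduction.comp (latticeStabilizer V).subtype).codRestrict _ fun g =>
      ⟨reduction_mem_orthogonalGroup g.2.1, g.2.2⟩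
  let φ := e.toMonoidHom.comp r
  have hφ : ∀ (g : latticeStabilizer V) (i : Fin 9),
      (V i).map (reduction g : Mod2 →ₗ[ZMod 2] Mod2) = V ((φ g : Equiv.Perm (Fin 9)) i) :=
    fun g i => he (r g) i
  have hker : ∀ g : latticeStabilizer V, φ g = 1 ↔
      ((g : Lattice ≃ₗ[ℤ] Lattice) = 1 ∨ (g : Lattice ≃ₗ[ℤ] Lattice) = LinearEquiv.neg ℤ) := by
    intro g
    change e (r g) = 1 ↔ _
    rw [e.map_eq_one_iff, Subtype.ext_iff]
    change reduction (g : Lattice ≃ₗ[ℤ] Lattice) = 1 ↔ _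
    refine ⟨eq_one_or_neg_of_reduction_eq_one g.2.1, ?_⟩
    rintro (h | h) <;> rw [h]
    exacts [map_one _, reduction_neg]
  refine ⟨φ, fun σ => ?_, hφ, hker, ?_⟩
  · obtain ⟨h, hh, hr⟩ := exists_reduction_eq (e.symm σ).2.1
    refine ⟨⟨h, hh, by change reduction h ∈ permuters V; rw [hr]; exact (e.symm σ).2.2⟩, ?_⟩
    exact (congrArg e (Subtype.ext hr)).trans (e.apply_symm_apply σ)
  · rintro ⟨ψ, hψ⟩
    obtain ⟨j, hj, hj2, σ, hσ, hjσ⟩ := hV.exists_sq_eq_neg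
    let J : latticeStabilizer V := ⟨j, hj, σ, hjσ⟩
    have hφJ : (φ J : Equiv.Perm (Fin 9)) = σ :=
      Equiv.ext fun i => hV.injective ((hφ J i).symm.trans (hjσ i))
    have hJ2 : φ J * φ J = 1 := Subtype.ext (by
      change (φ J : Equiv.Perm (Fin 9)) * φ J = 1
      rw [hφJ, hσ])
    -- a section would map `φ J` to an involution that differs from `J` by a sign
    have h1 : ψ (φ J) * ψ (φ J) = 1 := by rw [← map_mul, hJ2, map_one]
    have h2 : φ (ψ (φ J) * J⁻¹) = 1 := by
      rw [map_mul, map_inv, show φ (ψ (φ J)) = φ J from DFunLike.congr_fun hψ _, mul_inv_cancel]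
    have h3 : (ψ (φ J) : Lattice ≃ₗ[ℤ] Lattice) * ψ (φ J) = j * j := by
      have e1 : (ψ (φ J) : Lattice ≃ₗ[ℤ] Lattice) =
          ((ψ (φ J) * J⁻¹ : latticeStabilizer V) : Lattice ≃ₗ[ℤ] Lattice) * j := by
        change _ = (ψ (φ J) : Lattice ≃ₗ[ℤ] Lattice) * j⁻¹ * j
        rw [inv_mul_cancel_right]
      rcases (hker _).1 h2 with h | h
      · rw [e1, h, one_mul]
      · rw [e1, h]
        refine LinearEquiv.ext fun x => ?_
        change -(j (-(j x))) = j (j x)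
        rw [map_neg, neg_neg]
    have h4 : (1 : Lattice ≃ₗ[ℤ] Lattice) = LinearEquiv.neg ℤ := by
      rw [← hj2, ← h3]
      exact (congrArg Subtype.val h1).symm
    have h5 := congrFun (LinearEquiv.congr_fun h4 (simpleRoot 0)) 0
    change (Pi.single 0 1 : Lattice) 0 = -(Pi.single 0 1 : Lattice) 0 at h5
    rw [Pi.single_eq_same] at h5
    exact absurd h5 (by decide)

end E8Spread

theorem mainTheorem1 :
    -- `E₈ / 2 E₈` is an 8-dimensional quadratic space of plus type with 135 isotropic points
    Nonempty (E8Spread.Q.IsometryEquiv (QuadraticForm.dualProd (ZMod 2) (Fin 4 → ZMod 2))) ∧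
    E8Spread.isotropicPoints.ncard = 135 ∧
    -- the partition exists, and may be started from any two disjoint isotropic 4-spaces
    (∃ V, E8Spread.IsPartition V) ∧
    (∀ W₁ W₂, E8Spread.IsIsotropic4Space W₁ → E8Spread.IsIsotropic4Space W₂ → Disjoint W₁ W₂ →
      ∃ V, E8Spread.IsPartition V ∧ V 0 = W₁ ∧ V 1 = W₂) ∧
    ∀ V, E8Spread.IsPartition V →
      (∀ i, {v | v ∈ V i ∧ v ≠ 0}.ncard = 15) ∧
      -- three subgroups `A₇`, extending a common `A₆`, generate a subgroup `A₉` of `O₈⁺(2)`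
      (∃ K H₀₁ H₀₂ H₁₂ : Subgroup (E8Spread.Mod2 ≃ₗ[ZMod 2] E8Spread.Mod2),
        E8Spread.ActsAsAlternating K V {0, 1, 2}ᶜ ∧
        E8Spread.ActsAsAlternating H₀₁ V {0, 1}ᶜ ∧
        E8Spread.ActsAsAlternating H₀₂ V {0, 2}ᶜ ∧
        E8Spread.ActsAsAlternating H₁₂ V {1, 2}ᶜ ∧
        K ≤ H₀₁ ∧ K ≤ H₀₂ ∧ K ≤ H₁₂ ∧
        H₀₁ ≤ E8Spread.O8plus ∧ H₀₂ ≤ E8Spread.O8plus ∧ H₁₂ ≤ E8Spread.O8plus ∧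
        E8Spread.ActsAsAlternating (H₀₁ ⊔ H₀₂ ⊔ H₁₂) V Finset.univ ∧
        H₀₁ ⊔ H₀₂ ⊔ H₁₂ = E8Spread.orthogonalGroup ⊓ E8Spread.permuters V) ∧
      -- the stabilizer of the partition in `Aut(E₈)` is the double cover `2A₉`
      (∃ φ : E8Spread.latticeStabilizer V →* alternatingGroup (Fin 9),
        Function.Surjective φ ∧
        (∀ (g : E8Spread.latticeStabilizer V) (i : Fin 9),
          (V i).map (E8Spread.reduction g : E8Spread.Mod2 →ₗ[ZMod 2] E8Spread.Mod2) =
            V ((φ g : Equiv.Perm (Fin 9)) i)) ∧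
        (∀ g : E8Spread.latticeStabilizer V, φ g = 1 ↔
          ((g : E8Spread.Lattice ≃ₗ[ℤ] E8Spread.Lattice) = 1 ∨
            (g : E8Spread.Lattice ≃ₗ[ℤ] E8Spread.Lattice) = LinearEquiv.neg ℤ)) ∧
        ¬ ∃ ψ : alternatingGroup (Fin 9) →* E8Spread.latticeStabilizer V,
          φ.comp ψ = MonoidHom.id _) := by
  refine ⟨E8Spread.nonempty_isometryEquiv, E8Spread.ncard_isotropicPoints,
    ⟨_, E8Spread.isPartition_of_isometry E8Spread.modelForm_coordEquiv⟩,
    fun W₁ W₂ => E8Spread.exists_isPartition_of_disjoint, fun V hV =>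
      ⟨hV.ncard_ne_zero, hV.exists_subgroups, hV.exists_doubleCover⟩⟩
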